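/- All algebras are associative complex algebras, not necessarily unital; $\mathbb N=\{1,2,\dots\}$. *Complexes.* For an algebra $A$ and a tuple $(a_0,\dots,a_n)$ put $d_i(a_0\otimes\cdots\otimes a_n)=a_0\otimes\cdots\otimes a_ia_{i+1}\otimes\cdots\otimes a_n$ for $0\le i<n$ and $d_n(a_0\otimes\cdots\otimes a_n)=a_na_0\otimes a_1\otimes\cdots\otimes a_{n-1}$, and let $\beta=\sum_{i=0}^{n-1}(-1)^id_i$ and $\delta=\sum_{i=0}^{n}(-1)^id_i$ on $A^{\otimes(n+1)}$. The algebra $A$ is *H-unital* if the bar complex $0\leftarrow A\xleftarrow{\beta}A\otimes A\xleftarrow{\beta}A^{\otimes3}\leftarrow\cdots$ is acyclic. $H^n(A,A')$ is the $n$-th cohomology group of the algebraic dual of the complex $0\leftarrow A\xleftarrow{\delta}A\otimes A\xleftarrow{\delta}\cdots$ (with $(A^{\otimes(n+1)})'$ in degree $n$). For a Banach algebra $\mathfrak A$ the same formulas on projective tensor powers define a bar complex $\mathbf B_\bullet(\mathfrak A)$ and a Hochschild complex of Banach spaces; $\mathfrak A$ is *strongly H-unital* if $X\widehat\otimes\mathbf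 B_\bullet(\mathfrak A)$ is acyclic for every Banach space $X$, and $\mathcal H^n(\mathfrak A,\mathfrak A^*)$ is the $n$-th cohomology group of the topological dual of the Hochschild complex (with $(\mathfrak A^{\widehat\otimes(n+1)})^*$ in degree $n$). *Matrix structure.* A bounded multiplier $T$ of $\mathfrak A$ is a pair of bounded linear maps $a\mapsto Ta$, $a\mapsto aT$ with $T(ab)=(Ta)b$, $(ab)T=a(bT)$, $(aT)b=a(Tb)$. Let $S,R$ be bounded multipliers with $RS=\mathbf 1$ and $SR\ne\mathbf 1$. Put $\mathfrak A_k=\{a\in\mathfrak A: R^ka=aS^k=0\}$ for $k\in\mathbb N$, $\mathfrak A_\infty=\bigcup_{k\ge1}\mathfrak A_k$, and $E_{ij}=S^{i-1}(\mathbf 1-SR)R^{j-1}$ for $i,j\in\mathbb N$. A scalar matrix $U=(u_{ij})_{i,j\in\mathbb N}$ with finitely many nonzero entries in each row and column acts on $a\in\mathfrak A_\infty$ by the finite sums $Ua=\sum_{i,j}u_{ij}E_{ij}a$ and $aU=\sum_{i,j}u_{ij}aE_{ij}$. * **M1.** $\mathfrak A_\infty$ is dense in $\mathfrak A$, and there is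 a constant $C$ such that $\bigl\|\sum_{l=1}^nS^{lk}aR^{lk}\bigr\|\le C\|a\|$ for all $k,n\in\mathbb N$ and all $a\in\mathfrak A_k$. * **M2.** There is a dense subalgebra $A\subseteq\mathfrak A$ such that the algebra $A_\infty=A\cap\mathfrak A_\infty$ is H-unital and $H^n(A_\infty,A_\infty')=\{0\}$ for all $n\ge1$. * **M3.** There is $C>0$ such that $\|aU\|\le C\|a\|$ and $\|Ua\|\le C\|a\|$ for all $a\in\mathfrak A_\infty$ and all matrices $U=D\Pi_{\mathfrak p}$, where $\Pi_{\mathfrak p}$ is the permutation matrix of a permutation $\mathfrak p$ of $\mathbb N$ that moves only finitely many points, and $D$ is a diagonal matrix with finitely many diagonal entries $-1$ and all others $+1$. **Theorem.** Let $\mathfrak A$ be a strongly H-unital Banach algebra with bounded multipliers $S,R$ as above that satisfies M1, M2 and M3. Then $\mathcal H^n(\mathfrak A,\mathfrak A^*)=\{0\}$ for all $n\ge1$. -/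

import Mathlib

open scoped TensorProduct MultiplierAlgebra

universe u

noncomputable section

namespace MatrixLike

/-- The quotient of `Z` by `Z ∩ B`, for subspaces `Z` (cocycles) and `B` (coboundaries). -/
def Subquotient {C : Type*} [AddCommGroup C] [Module ℂ C] (Z B : Submodule ℂ C) : Type _ :=
  Z ⧸ B.submoduleOf Z

section Faces

variable {A : Type*} [NonUnitalRing A]

/-- `d_i (a_0, …, a_n) = (a_0, …, a_i a_{i+1}, …, a_n)` for `i < n`, on `(n+1)`-tuples. -/
def innerFace {n : ℕ} (i : Fin n) (a : Fin (n + 1) → A) : Fin n → A :=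
  Fin.contractNth i.castSucc (· * ·) a

/-- The last face `d_n (a_0, …, a_n) = (a_n a_0, a_1, …, a_{n-1})`, for `n ≥ 1` (written with
`n + 1` in place of `n`). -/
def lastFace {n : ℕ} (a : Fin (n + 2) → A) : Fin (n + 1) → A :=
  Fin.cons (a (Fin.last (n + 1)) * a 0) fun k : Fin n => a k.succ.castSucc

variable [Module ℂ A] [IsScalarTower ℂ A A] [SMulCommClass ℂ A A]

/-- A map of tuples is slotwise linear if varying one entry of the argument varies one entry of the
value, linearly. Multilinear maps can be composed with such maps. -/
def SlotwiseLinear {m n : ℕ} (g : (Fin m → A) → (Fin n → A)) : Prop :=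
  ∀ (a : Fin m → A) (j : Fin m), ∃ (k : Fin n) (L : A →ₗ[ℂ] A),
    ∀ x, g (Function.update a j x) = Function.update (g a) k (L x)

theorem slotwiseLinear_innerFace {n : ℕ} (i : Fin n) :
    SlotwiseLinear (innerFace i : (Fin (n + 1) → A) → Fin n → A) := by
  intro a j
  rcases lt_trichotomy (j : ℕ) i with h | h | h
  · refine ⟨⟨j, by omega⟩, LinearMap.id, fun x => ?_⟩
    ext k
    simp only [innerFace, Fin.contractNth, Function.update_apply, Fin.ext_iff, Fin.val_castSucc,
      Fin.val_succ, LinearMap.id_apply]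
    split_ifs <;> first | rfl | omega
  · refine ⟨i, LinearMap.mulRight ℂ (a i.succ), fun x => ?_⟩
    ext k
    simp only [innerFace, Fin.contractNth, Function.update_apply, Fin.ext_iff, Fin.val_castSucc,
      Fin.val_succ, LinearMap.mulRight_apply]
    split_ifs with h1 h2 h3 h4 h5 <;> first | rfl | omega |
      (obtain rfl : k = i := Fin.ext (by omega)); rfl
  · by_cases h' : (j : ℕ) = i + 1
    · refine ⟨i, LinearMap.mulLeft ℂ (a i.castSucc), fun x => ?_⟩
      ext k
      simp only [innerFace, Fin.contractNth, Function.update_apply, Fin.ext_iff, Fin.val_castSucc,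
        Fin.val_succ, LinearMap.mulLeft_apply]
      split_ifs with h1 h2 h3 h4 h5 <;> first | rfl | omega |
      (obtain rfl : k = i := Fin.ext (by omega)); rfl
    · refine ⟨⟨j - 1, by omega⟩, LinearMap.id, fun x => ?_⟩
      ext k
      simp only [innerFace, Fin.contractNth, Function.update_apply, Fin.ext_iff, Fin.val_castSucc,
        Fin.val_succ, LinearMap.id_apply]
      split_ifs <;> first | rfl | omega

theorem slotwiseLinear_lastFace {n : ℕ} :
    SlotwiseLinear (lastFace : (Fin (n + 2) → A) → Fin (n + 1) → A) := by
  intro a j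
  by_cases h0 : (j : ℕ) = 0
  · refine ⟨0, LinearMap.mulLeft ℂ (a (Fin.last (n + 1))), fun x => ?_⟩
    ext k
    refine Fin.cases ?_ (fun k => ?_) k
    · simp [lastFace, Function.update_apply, Fin.ext_iff, h0]
    · simp [lastFace, Function.update_apply, Fin.ext_iff, h0]
  · by_cases hl : (j : ℕ) = n + 1
    · refine ⟨0, LinearMap.mulRight ℂ (a 0), fun x => ?_⟩
      ext k
      refine Fin.cases ?_ (fun k => ?_) k
      · simp [lastFace, Function.update_apply, Fin.ext_iff, hl]
      · have := k.isLt
        simp [lastFace, Function.update_apply, Fin.ext_iff, hl]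
        omega
    · refine ⟨⟨j, by omega⟩, LinearMap.id, fun x => ?_⟩
      ext k
      refine Fin.cases ?_ (fun k => ?_) k
      · simp [lastFace, Function.update_apply, Fin.ext_iff, Ne.symm h0, Ne.symm hl]
      · simp [lastFace, Function.update_apply, Fin.ext_iff]

/-- Composition `a ↦ f (g a)` of a multilinear map with a slotwise linear map of tuples. -/
def compTuple {N : Type*} [AddCommGroup N] [Module ℂ N] {m n : ℕ} {g : (Fin m → A) → (Fin n → A)}
    (hg : SlotwiseLinear g) (f : MultilinearMap ℂ (fun _ : Fin n => A) N) :
    MultilinearMap ℂ (fun _ : Fin m => A) N where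
  toFun a := f (g a)
  map_update_add' := by
    intro inst a j x y
    rw [Subsingleton.elim inst (instDecidableEqFin m)]
    obtain ⟨k, L, h⟩ := hg a j
    simp only [h, map_add, MultilinearMap.map_update_add]
  map_update_smul' := by
    intro inst a j c x
    rw [Subsingleton.elim inst (instDecidableEqFin m)]
    obtain ⟨k, L, h⟩ := hg a j
    simp only [h, map_smul, MultilinearMap.map_update_smul]

@[simp]
theorem compTuple_apply {N : Type*} [AddCommGroup N] [Module ℂ N] {m n : ℕ}
    {g : (Fin m → A) → (Fin n → A)} (hg : SlotwiseLinear g)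
    (f : MultilinearMap ℂ (fun _ : Fin n => A) N) (a : Fin m → A) :
    compTuple hg f a = f (g a) := rfl

/-! ### Algebraic bar complex and Hochschild cohomology -/

variable (A)

/-- The bar differential `β = ∑_{i<n} (-1)^i d_i` from `n`-chains `A^{⊗(n+1)}` to `A^{⊗n}`; it is
zero for `n = 0`. -/
def bar (n : ℕ) : (⨂[ℂ] _ : Fin (n + 1), A) →ₗ[ℂ] ⨂[ℂ] _ : Fin n, A :=
  ∑ i : Fin n, (-1 : ℂ) ^ (i : ℕ) •
    PiTensorProduct.lift (compTuple (slotwiseLinear_innerFace i) (PiTensorProduct.tprod ℂ))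

/-- `A` is H-unital: the complex `0 ← A ← A ⊗ A ← A ⊗ A ⊗ A ← ⋯` is acyclic. -/
def IsHUnital : Prop :=
  ∀ n : ℕ, Function.Exact (bar A (n + 1)) (bar A n)

/-- Algebraic `n`-cochains: linear functionals on `A^{⊗(n+1)}`, i.e. `(n+1)`-linear functionals. -/
abbrev Cochain (n : ℕ) : Type _ := MultilinearMap ℂ (fun _ : Fin (n + 1) => A) ℂ

/-- The dual of the Hochschild differential:
`(∂ φ)(a) = ∑_{i ≤ n} (-1)^i φ (d_i a) + (-1)^{n+1} φ (d_{n+1} a)` for an `n`-cochain `φ`. -/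
def coboundary (n : ℕ) : Cochain A n →ₗ[ℂ] Cochain A (n + 1) where
  toFun φ := ∑ i : Fin (n + 1), (-1 : ℂ) ^ (i : ℕ) • compTuple (slotwiseLinear_innerFace i) φ
    + (-1 : ℂ) ^ (n + 1) • compTuple slotwiseLinear_lastFace φ
  map_add' φ ψ := by
    ext a
    simp [mul_add, Finset.sum_add_distrib]
    ring
  map_smul' c φ := by
    ext a
    simp [Finset.mul_sum, mul_left_comm]

/-- The `n`-coboundaries; in degree `0` there are none but `0`. -/
def coboundaries : (n : ℕ) → Submodule ℂ (Cochain A n)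
  | 0 => ⊥
  | n + 1 => LinearMap.range (coboundary A n)

/-- The algebraic Hochschild cohomology group `Hⁿ(A, A')`: cocycles modulo coboundaries. -/
def HochschildCohomology (n : ℕ) : Type _ :=
  Subquotient (LinearMap.ker (coboundary A n)) (coboundaries A n)

end Faces

section Bounded

variable {A : Type u} [NonUnitalNormedRing A]

theorem continuous_innerFace {n : ℕ} (i : Fin n) :
    Continuous (innerFace i : (Fin (n + 1) → A) → Fin n → A) := by
  refine continuous_pi fun k => ?_
  simp only [innerFace, Fin.contractNth]
  split_ifs <;> fun_prop

theorem continuous_lastFace {n : ℕ} :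
    Continuous (lastFace : (Fin (n + 2) → A) → Fin (n + 1) → A) := by
  refine continuous_pi fun k => ?_
  refine Fin.cases ?_ (fun k => ?_) k
  · simp only [lastFace, Fin.cons_zero]; fun_prop
  · simp only [lastFace, Fin.cons_succ]; fun_prop

variable [NormedSpace ℂ A] [SMulCommClass ℂ A A] [IsScalarTower ℂ A A]

/-- Composition of a bounded multilinear map with a continuous slotwise linear map of tuples. -/
def compTupleL {N : Type*} [SeminormedAddCommGroup N] [NormedSpace ℂ N] {m n : ℕ}
    {g : (Fin m → A) → (Fin n → A)} (hg : SlotwiseLinear g) (hc : Continuous g)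
    (f : ContinuousMultilinearMap ℂ (fun _ : Fin n => A) N) :
    ContinuousMultilinearMap ℂ (fun _ : Fin m => A) N where
  toMultilinearMap := compTuple hg f.toMultilinearMap
  cont := f.cont.comp hc

@[simp]
theorem compTupleL_apply {N : Type*} [SeminormedAddCommGroup N] [NormedSpace ℂ N] {m n : ℕ}
    {g : (Fin m → A) → (Fin n → A)} (hg : SlotwiseLinear g) (hc : Continuous g)
    (f : ContinuousMultilinearMap ℂ (fun _ : Fin n => A) N) (a : Fin m → A) :
    compTupleL hg hc f a = f (g a) := rfl

/-! ### Projective tensor products and strong H-unitality -/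

variable (A)

/-- The projective tensor power `A^{⊗̂ n}`: the completion of the algebraic one in the projective
seminorm. -/
abbrev ProjPower (n : ℕ) : Type u := UniformSpace.Completion (⨂[ℂ] _ : Fin n, A)

/-- The bar differential `β : A^{⊗̂(n+1)} → A^{⊗̂ n}`. -/
def barL (n : ℕ) : ProjPower A (n + 1) →L[ℂ] ProjPower A n :=
  (∑ i : Fin n, (-1 : ℂ) ^ (i : ℕ) •
    PiTensorProduct.liftIsometry ℂ (fun _ : Fin (n + 1) => A) (⨂[ℂ] _ : Fin n, A)
      (compTupleL (slotwiseLinear_innerFace i) (continuous_innerFace i)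
        (PiTensorProduct.tprodL ℂ))).completion

/-- The two-member family consisting of `X` and `Y`. -/
def Pair (X Y : Type u) : Bool → Type u
  | false => X
  | true => Y

instance (X Y : Type u) [NormedAddCommGroup X] [NormedAddCommGroup Y] :
    ∀ b, NormedAddCommGroup (Pair X Y b)
  | false => inferInstanceAs (NormedAddCommGroup X)
  | true => inferInstanceAs (NormedAddCommGroup Y)

instance (X Y : Type u) [NormedAddCommGroup X] [NormedSpace ℂ X] [NormedAddCommGroup Y]
    [NormedSpace ℂ Y] : ∀ b, NormedSpace ℂ (Pair X Y b)
  | false => inferInstanceAs (NormedSpace ℂ X)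
  | true => inferInstanceAs (NormedSpace ℂ Y)

/-- The projective tensor product `X ⊗̂ Y`. -/
abbrev ProjTensor (X Y : Type u) [NormedAddCommGroup X] [NormedSpace ℂ X] [NormedAddCommGroup Y]
    [NormedSpace ℂ Y] : Type u :=
  UniformSpace.Completion (⨂[ℂ] b : Bool, Pair X Y b)

/-- The family `(id_X, T)` of maps between the members of the pairs `(X, Y)` and `(X, Z)`. -/
def pairMap (X : Type u) {Y Z : Type u} [NormedAddCommGroup X] [NormedSpace ℂ X]
    [NormedAddCommGroup Y] [NormedSpace ℂ Y] [NormedAddCommGroup Z] [NormedSpace ℂ Z]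
    (T : Y →L[ℂ] Z) : ∀ b, Pair X Y b →L[ℂ] Pair X Z b
  | false => ContinuousLinearMap.id ℂ X
  | true => T

/-- The bounded map `id_X ⊗̂ T : X ⊗̂ Y → X ⊗̂ Z`. -/
def idTensor (X : Type u) {Y Z : Type u} [NormedAddCommGroup X] [NormedSpace ℂ X]
    [NormedAddCommGroup Y] [NormedSpace ℂ Y] [NormedAddCommGroup Z] [NormedSpace ℂ Z]
    (T : Y →L[ℂ] Z) : ProjTensor X Y →L[ℂ] ProjTensor X Z :=
  (PiTensorProduct.mapL (pairMap X T)).completion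

/-- `A` is strongly H-unital: `X ⊗̂ B_•(A)` is acyclic for every Banach space `X`, where
`B_•(A)` is the complex `0 ← A ← A ⊗̂ A ← A ⊗̂ A ⊗̂ A ← ⋯`. -/
def IsStronglyHUnital : Prop :=
  ∀ (X : Type u) [NormedAddCommGroup X] [NormedSpace ℂ X] [CompleteSpace X] (n : ℕ),
    Function.Exact (idTensor X (barL A (n + 1))) (idTensor X (barL A n))

/-! ### Bounded Hochschild cohomology -/

/-- Bounded `n`-cochains: bounded linear functionals on `A^{⊗̂(n+1)}`, i.e. bounded
`(n+1)`-linear functionals on `A`. -/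
abbrev BoundedCochain (n : ℕ) : Type _ := ContinuousMultilinearMap ℂ (fun _ : Fin (n + 1) => A) ℂ

/-- The dual of the Hochschild differential on bounded cochains. -/
def boundedCoboundary (n : ℕ) : BoundedCochain A n →ₗ[ℂ] BoundedCochain A (n + 1) where
  toFun φ := ∑ i : Fin (n + 1), (-1 : ℂ) ^ (i : ℕ) •
      compTupleL (slotwiseLinear_innerFace i) (continuous_innerFace i) φ
    + (-1 : ℂ) ^ (n + 1) • compTupleL slotwiseLinear_lastFace continuous_lastFace φ
  map_add' φ ψ := by
    ext a
    simp [mul_add, Finset.sum_add_distrib]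
    ring
  map_smul' c φ := by
    ext a
    simp [Finset.mul_sum, mul_left_comm]

/-- The bounded `n`-coboundaries; in degree `0` there are none but `0`. -/
def boundedCoboundaries : (n : ℕ) → Submodule ℂ (BoundedCochain A n)
  | 0 => ⊥
  | n + 1 => LinearMap.range (boundedCoboundary A n)

/-- The bounded Hochschild cohomology group `ℋⁿ(A, A*)`: cocycles modulo coboundaries. -/
def BoundedHochschildCohomology (n : ℕ) : Type _ :=
  Subquotient (LinearMap.ker (boundedCoboundary A n)) (boundedCoboundaries A n)

/-! ### Multipliers and the matrix structure -/

/-- The algebra of bounded multipliers of `A`: pairs of bounded linear maps `a ↦ T a` and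
`a ↦ a T` with `(a T) b = a (T b)`, `T (a b) = (T a) b` and `(a b) T = a (b T)`. -/
def multipliers : Subalgebra ℂ 𝓜(ℂ, A) where
  carrier := {T | (∀ a b, T.fst (a * b) = T.fst a * b) ∧ ∀ a b, T.snd (a * b) = a * T.snd b}
  mul_mem' := by
    rintro T T' ⟨h1, h2⟩ ⟨h1', h2'⟩
    exact ⟨fun a b => by simp [h1, h1'], fun a b => by simp [h2, h2']⟩
  add_mem' := by
    rintro T T' ⟨h1, h2⟩ ⟨h1', h2'⟩
    exact ⟨fun a b => by simp [h1, h1', add_mul], fun a b => by simp [h2, h2', mul_add]⟩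
  algebraMap_mem' c := by
    refine ⟨fun a b => ?_, fun a b => ?_⟩
    · simp [Algebra.algebraMap_eq_smul_one, smul_mul_assoc]
    · simp [Algebra.algebraMap_eq_smul_one, mul_smul_comm]

variable {A}

/-- `T a` -/
def lmul (T : multipliers A) (a : A) : A := T.1.fst a

/-- `a T` -/
def rmul (a : A) (T : multipliers A) : A := T.1.snd a

theorem lmul_pow_eq_zero (T : multipliers A) {k m : ℕ} (h : k ≤ m) {a : A}
    (ha : lmul (T ^ k) a = 0) : lmul (T ^ m) a = 0 := by
  obtain ⟨d, rfl⟩ := Nat.exists_eq_add_of_le h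
  rw [add_comm, pow_add]
  change (T ^ d).1.fst ((T ^ k).1.fst a) = 0
  rw [show (T ^ k).1.fst a = 0 from ha, map_zero]

theorem rmul_pow_eq_zero (T : multipliers A) {k m : ℕ} (h : k ≤ m) {a : A}
    (ha : rmul a (T ^ k) = 0) : rmul a (T ^ m) = 0 := by
  obtain ⟨d, rfl⟩ := Nat.exists_eq_add_of_le h
  rw [pow_add]
  change (T ^ d).1.snd ((T ^ k).1.snd a) = 0
  rw [show (T ^ k).1.snd a = 0 from ha, map_zero]

/-- `𝔄_k = {a | R^k a = a S^k = 0}`, the `k × k` upper left hand corners. -/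
def corner (S R : multipliers A) (k : ℕ) : Set A :=
  {a | lmul (R ^ k) a = 0 ∧ rmul a (S ^ k) = 0}

/-- For a subalgebra `B`, the subalgebra `B_∞ = ⋃_{k ≥ 1} B ∩ 𝔄_k`. -/
def corners (S R : multipliers A) (B : NonUnitalSubalgebra ℂ A) : NonUnitalSubalgebra ℂ A where
  carrier := {a | a ∈ B ∧ ∃ k : ℕ, 1 ≤ k ∧ a ∈ corner S R k}
  zero_mem' := ⟨B.zero_mem, 1, le_rfl, by simp [corner, lmul, rmul]⟩
  add_mem' := by
    rintro a b ⟨ha, k, hk, hka, hka'⟩ ⟨hb, m, hm, hmb, hmb'⟩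
    refine ⟨B.add_mem ha hb, max k m, le_trans hk (le_max_left _ _), ?_, ?_⟩
    · have h1 := lmul_pow_eq_zero R (le_max_left k m) hka
      have h2 := lmul_pow_eq_zero R (le_max_right k m) hmb
      simp only [lmul] at h1 h2 ⊢
      rw [map_add, h1, h2, add_zero]
    · have h1 := rmul_pow_eq_zero S (le_max_left k m) hka'
      have h2 := rmul_pow_eq_zero S (le_max_right k m) hmb'
      simp only [rmul] at h1 h2 ⊢
      rw [map_add, h1, h2, add_zero]
  mul_mem' := by
    rintro a b ⟨ha, k, hk, hka, hka'⟩ ⟨hb, m, hm, hmb, hmb'⟩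
    refine ⟨B.mul_mem ha hb, max k m, le_trans hk (le_max_left _ _), ?_, ?_⟩
    · have h1 := lmul_pow_eq_zero R (le_max_left k m) hka
      simp only [lmul] at h1 ⊢
      rw [(R ^ max k m).2.1, h1, zero_mul]
    · have h2 := rmul_pow_eq_zero S (le_max_right k m) hmb'
      simp only [rmul] at h2 ⊢
      rw [(S ^ max k m).2.2, h2, mul_zero]
  smul_mem' := by
    rintro c a ⟨ha, k, hk, hka, hka'⟩
    refine ⟨B.smul_mem c ha, k, hk, ?_, ?_⟩
    · simp only [lmul] at hka ⊢
      rw [map_smul, hka, smul_zero]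
    · simp only [rmul] at hka' ⊢
      rw [map_smul, hka', smul_zero]

/-- Condition M1: `𝔄_∞` is dense, and block diagonal matrices with equal `k × k` blocks are
bounded, uniformly in the size and in the number of the blocks. -/
def ConditionM1 (S R : multipliers A) : Prop :=
  Dense (corners S R ⊤ : Set A) ∧
  ∃ C : ℝ, ∀ k : ℕ, 1 ≤ k → ∀ a ∈ corner S R k, ∀ n : ℕ,
    ‖∑ l ∈ Finset.Icc 1 n, lmul (S ^ (l * k)) (rmul a (R ^ (l * k)))‖ ≤ C * ‖a‖

/-- Condition M2. -/
def ConditionM2 (S R : multipliers A) : Prop :=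
  ∃ B : NonUnitalSubalgebra ℂ A, Dense (B : Set A) ∧ IsHUnital (corners S R B) ∧
    ∀ n : ℕ, 1 ≤ n → Subsingleton (HochschildCohomology (corners S R B) n)

/-- The matrix units `E_{ij} = S^i (1 - S R) R^j` (indices from `0`); `E_{ii} = S^i R^i -
S^{i+1} R^{i+1}` is the projection onto the coordinate `i`, and `E_{ij}` moves the coordinate `j`
to the coordinate `i`. -/
def matrixUnit (S R : multipliers A) (i j : ℕ) : multipliers A :=
  S ^ i * (1 - S * R) * R ^ j

/-- Left multiplication `U a = ∑_{i,j} U_{ij} E_{ij} a` by a scalar matrix. If `a` is in `𝔄_k`,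
only the terms with `j < k` can be nonzero. -/
def matrixLMul (S R : multipliers A) (U : Matrix ℕ ℕ ℂ) (a : A) : A :=
  ∑ᶠ q : ℕ × ℕ, U q.1 q.2 • lmul (matrixUnit S R q.1 q.2) a

/-- Right multiplication `a U = ∑_{i,j} U_{ij} a E_{ij}` by a scalar matrix. If `a` is in `𝔄_k`,
only the terms with `i < k` can be nonzero. -/
def matrixRMul (S R : multipliers A) (a : A) (U : Matrix ℕ ℕ ℂ) : A :=
  ∑ᶠ q : ℕ × ℕ, U q.1 q.2 • rmul a (matrixUnit S R q.1 q.2)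

/-- The signed finite permutation matrices `U = D Π_p`: `p` moves finitely many points, and `D` is
diagonal with finitely many entries `-1` and all others `1`. -/
def signedPermutations : Set (Matrix ℕ ℕ ℂ) :=
  {U | ∃ (ε : ℕ → ℂ) (p : Equiv.Perm ℕ), (∀ i, ε i = 1 ∨ ε i = -1) ∧ {i | ε i = -1}.Finite ∧
    {i | p i ≠ i}.Finite ∧ ∀ i j, U i j = ε i * p.permMatrix ℂ i j}

/-- Condition M3: the signed finite permutation matrices act boundedly on `𝔄_∞`. -/
def ConditionM3 (S R : multipliers A) : Prop :=
  ∃ C : ℝ, 0 < C ∧ ∀ U ∈ signedPermutations, ∀ a ∈ corners S R (⊤ : NonUnitalSubalgebra ℂ A),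
    ‖matrixRMul S R a U‖ ≤ C * ‖a‖ ∧ ‖matrixLMul S R U a‖ ≤ C * ‖a‖

end Bounded

end MatrixLike

end

/-!
### Outline

Matrix units act on cochains across the gap between two cyclically consecutive slots. Averaging over
signed permutation matrices normalizes a cochain at one gap; strong H-unitality turns the
difference into a coboundary modulo terms that are already normalized, so every bounded cocycle is
cohomologous to one that is normalized at all gaps. Such a cocycle takes on block diagonal matrices
with `n` equal blocks `n` times its value on one block, and the bound on block diagonal matrices
forces it to vanish. The argument does not use the vanishing of algebraic cohomology.
-/

noncomputable section

namespace MatrixLike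

set_option linter.unusedSectionVars false
set_option maxSynthPendingDepth 3

open UniformSpace (Completion)

/-! ### Functionals on exact sequences of Banach spaces -/

/-! Regard the algebra as one of infinite matrices with matrix units E_ij. A cochain is normalized
at the gap between two cyclically neighbouring slots if φ(…, aE, b, …) = φ(…, a, Eb, …) for every
matrix unit E. The theorem follows from two facts.

A bounded cochain φ normalized at every gap is zero. Let D_n(a) be the block diagonal matrix with n
copies of a corner element a. A partial isometry from one block to the corner intertwines D_n(a)
with a, so it can be carried once round the cycle of slots (`map_update_block`); summing over the
blocks gives φ(D_n a_0, …, D_n a_m) = n φ(a_0, …, a_m). By M1 the left side stays bounded as n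
grows.

Every bounded cocycle of positive degree is cohomologous to one normalized at every gap. The average
over signed permutations acting across a gap is (N+1)⁻¹ ∑ E_ij ⊗ E_ji plus a tail term. M3 bounds
these averages uniformly (`norm_gapAverage_le`), and an ultrafilter limit of them is normalized at
that gap, keeps normalization at the other gaps, and changes nothing if the gap was normalized
already.

Descending induction on r makes the cocycle normalized from gap r on (`exists_normalizedFrom_sub`).
Let φ be a cocycle normalized from gap r + 1 on, and φ₁ its mean at gap r. Split ∂ into its first r
+ 1 faces and the rest. The rest respects normalization from gap r + 1 on
(`NormalizedFrom.tailSum`); by the cocycle identity so does the first part of ∂φ, which therefore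
does not change when φ is replaced by φ₁. Thus the first part kills φ - φ₁, and strong H-unitality
(`exists_eq_barSum`) writes this difference as the first r faces of the coboundary of some ψ.
Averaging makes ψ normalized from gap r on, and then φ - ∂ψ is φ₁ minus the remaining faces of ∂ψ,
so it is normalized from gap r on. -/

/-- A bounded functional that vanishes on the kernel of a bounded map with closed range factors
through that map. -/
theorem exists_factor_of_isClosed_range {V W : Type*} [NormedAddCommGroup V] [NormedSpace ℂ V]
    [CompleteSpace V] [NormedAddCommGroup W] [NormedSpace ℂ W] [CompleteSpace W] (T : V →L[ℂ] W)
    (hT : IsClosed (Set.range T)) (F : V →L[ℂ] ℂ) (hF : ∀ v, T v = 0 → F v = 0) :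
    ∃ G : W →L[ℂ] ℂ, F = G ∘L T := by
  let K : Submodule ℂ W := LinearMap.range T.toLinearMap
  have hK : IsClosed (K : Set W) := by
    have h : (K : Set W) = Set.range T := by ext; rfl
    rwa [h]
  have : CompleteSpace K := hK.completeSpace_coe
  let T' : V →L[ℂ] K := T.codRestrict K fun v => ⟨v, rfl⟩
  have hsurj : Function.Surjective T' := by
    rintro ⟨_, v, rfl⟩
    exact ⟨v, rfl⟩
  obtain ⟨C, -, hC⟩ := T'.exists_preimage_norm_le hsurj
  -- The section `s` is bounded by the open mapping theorem but need not be linear. Linearity of `F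
  -- ∘ s` comes from `F` vanishing on the kernel of `T`.
  choose s hs hsC using hC
  have key : ∀ v w : V, T' v = T' w → F v = F w := fun v w h => by
    have h' : T (v - w) = 0 := by
      rw [map_sub, sub_eq_zero]
      exact congrArg Subtype.val h
    simpa [sub_eq_zero] using hF _ h'
  let G₀ : K →ₗ[ℂ] ℂ :=
    { toFun := fun w => F (s w)
      map_add' := fun x y => by rw [← map_add]; exact key _ _ (by simp [hs])
      map_smul' := fun c x => by
        rw [RingHom.id_apply, ← map_smul]; exact key _ _ (by simp [hs]) }
  let G₁ : K →L[ℂ] ℂ := G₀.mkContinuous (‖F‖ * C) fun w => by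
    calc ‖F (s w)‖ ≤ ‖F‖ * ‖s w‖ := F.le_opNorm _
      _ ≤ ‖F‖ * (C * ‖w‖) := by gcongr; exact hsC w
      _ = _ := by ring
  obtain ⟨G, hG, -⟩ := exists_extension_norm_eq K G₁
  refine ⟨G, ContinuousLinearMap.ext fun v => ?_⟩
  have h := hG (T' v)
  change G (T v) = F (s (T' v)) at h
  rw [ContinuousLinearMap.comp_apply, h]
  exact key _ _ (hs _).symm

/-! ### Maps out of completed tensor products -/

section Tensor

/-- The extension of a bounded map to the completion. -/
def extendCompletion {E F : Type*} [SeminormedAddCommGroup E] [NormedSpace ℂ E]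
    [NormedAddCommGroup F] [NormedSpace ℂ F] [CompleteSpace F] (f : E →L[ℂ] F) :
    Completion E →L[ℂ] F :=
  f.extend Completion.toComplL

@[simp]
theorem extendCompletion_coe {E F : Type*} [SeminormedAddCommGroup E] [NormedSpace ℂ E]
    [NormedAddCommGroup F] [NormedSpace ℂ F] [CompleteSpace F] (f : E →L[ℂ] F) (x : E) :
    extendCompletion f (x : Completion E) = f x :=
  f.extend_eq (e := Completion.toComplL) Completion.denseRange_coe
    (Completion.isUniformInducing_coe E) x

/-- Two bounded maps on a completed tensor product agree if they agree on elementary tensors. -/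
theorem completion_tensor_ext {ι : Type*} [Fintype ι] {E : ι → Type*}
    [∀ i, NormedAddCommGroup (E i)] [∀ i, NormedSpace ℂ (E i)] {F : Type*} [NormedAddCommGroup F]
    [NormedSpace ℂ F] {f g : Completion (⨂[ℂ] i, E i) →L[ℂ] F}
    (h : ∀ m : ∀ i, E i, f (PiTensorProduct.tprod ℂ m : ⨂[ℂ] i, E i) =
      g (PiTensorProduct.tprod ℂ m : ⨂[ℂ] i, E i)) : f = g := by
  ext x
  induction x using Completion.induction_on with
  | hp => exact isClosed_eq f.continuous g.continuous
  | ih x =>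
    have h' : f.toLinearMap ∘ₗ (Completion.toComplL : (⨂[ℂ] i, E i) →L[ℂ] _).toLinearMap =
        g.toLinearMap ∘ₗ (Completion.toComplL : (⨂[ℂ] i, E i) →L[ℂ] _).toLinearMap := by
      ext m
      simpa using h m
    simpa using LinearMap.congr_fun h' x

variable {X Y Z : Type u} [NormedAddCommGroup X] [NormedSpace ℂ X] [NormedAddCommGroup Y]
  [NormedSpace ℂ Y] [NormedAddCommGroup Z] [NormedSpace ℂ Z]

/-- The pair `(x, y)` as a member of the product of the family `Pair X Y`. -/
def pairElem (x : X) (y : Y) : ∀ b, Pair X Y b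
  | false => x
  | true => y

/-- A bounded bilinear map as a bounded multilinear map on a two-member family. -/
def bilinToMultilinear {W : Type*} [NormedAddCommGroup W] [NormedSpace ℂ W]
    (B : X →L[ℂ] Y →L[ℂ] W) : ContinuousMultilinearMap ℂ (Pair X Y) W :=
  MultilinearMap.mkContinuous
    { toFun := fun m => B (m false) (m true)
      map_update_add' := by
        intro inst m i x y
        rw [Subsingleton.elim inst instDecidableEqBool]
        cases i
        · exact (DFunLike.congr_fun (B.map_add x y) (m true) :)
        · exact (B (m false)).map_add x y
      map_update_smul' := by
        intro inst m i c x
        rw [Subsingleton.elim inst instDecidableEqBool]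
        cases i
        · exact (DFunLike.congr_fun (B.map_smul c x) (m true) :)
        · exact (B (m false)).map_smul c x }
    ‖B‖ fun m => by
      rw [Fintype.prod_bool, mul_comm ‖m true‖, ← mul_assoc]
      exact B.le_opNorm₂ (m false) (m true)

/-- The elementary tensor `x ⊗ y` in `X ⊗̂ Y`, as a bounded bilinear map. -/
def tmulL (X Y : Type u) [NormedAddCommGroup X] [NormedSpace ℂ X] [NormedAddCommGroup Y]
    [NormedSpace ℂ Y] : X →L[ℂ] Y →L[ℂ] ProjTensor X Y :=
  LinearMap.mkContinuous₂
    (LinearMap.mk₂ ℂ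
      (fun x y => ((PiTensorProduct.tprod ℂ (pairElem x y) : ⨂[ℂ] b, Pair X Y b) :
        ProjTensor X Y))
      (fun x x' y => by
        rw [← Completion.coe_add]
        congr 1
        have h := (PiTensorProduct.tprod ℂ).map_update_add (pairElem x y) false x x'
        convert h using 2 <;> [skip; congr 1; congr 1] <;> funext b <;> cases b <;> rfl)
      (fun c x y => by
        rw [← Completion.coe_smul]
        congr 1
        have h := (PiTensorProduct.tprod ℂ).map_update_smul (pairElem x y) false c x
        convert h using 2 <;> [skip; congr 1] <;> funext b <;> cases b <;> rfl)
      (fun x y y' => by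
        rw [← Completion.coe_add]
        congr 1
        have h := (PiTensorProduct.tprod ℂ).map_update_add (pairElem x y) true y y'
        convert h using 2 <;> [skip; congr 1; congr 1] <;> funext b <;> cases b <;> rfl)
      (fun c x y => by
        rw [← Completion.coe_smul]
        congr 1
        have h := (PiTensorProduct.tprod ℂ).map_update_smul (pairElem x y) true c y
        convert h using 2 <;> [skip; congr 1] <;> funext b <;> cases b <;> rfl))
    1 fun x y => by
      rw [one_mul, LinearMap.mk₂_apply, Completion.norm_coe]
      refine (PiTensorProduct.projectiveSeminorm_tprod_le _).trans_eq ?_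
      rw [Fintype.prod_bool, mul_comm]
      rfl

theorem tmulL_apply (x : X) (y : Y) : tmulL X Y x y =
    ((PiTensorProduct.tprod ℂ (pairElem x y) : ⨂[ℂ] b, Pair X Y b) : ProjTensor X Y) := rfl

theorem projTensor_ext {W : Type*} [NormedAddCommGroup W] [NormedSpace ℂ W]
    {f g : ProjTensor X Y →L[ℂ] W} (h : ∀ x y, f (tmulL X Y x y) = g (tmulL X Y x y)) : f = g := by
  refine completion_tensor_ext fun m => ?_
  have hm : m = pairElem (m false) (m true) := by funext b; cases b <;> rfl
  rw [hm]
  exact h _ _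

theorem idTensor_tmulL (T : Y →L[ℂ] Z) (x : X) (y : Y) :
    idTensor X T (tmulL X Y x y) = tmulL X Z x (T y) := by
  rw [tmulL_apply, tmulL_apply, idTensor, ContinuousLinearMap.completion_apply_coe,
    PiTensorProduct.mapL_apply, PiTensorProduct.map_tprod]
  congr 2
  funext b
  cases b <;> rfl

/-- The functional on `X ⊗̂ Y` defined by a bounded bilinear form. -/
def liftBilin (B : X →L[ℂ] Y →L[ℂ] ℂ) : ProjTensor X Y →L[ℂ] ℂ :=
  extendCompletion (PiTensorProduct.liftIsometry ℂ (Pair X Y) ℂ (bilinToMultilinear B))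

theorem liftBilin_tmulL (B : X →L[ℂ] Y →L[ℂ] ℂ) (x : X) (y : Y) :
    liftBilin B (tmulL X Y x y) = B x y := by
  rw [tmulL_apply, liftBilin, extendCompletion_coe, PiTensorProduct.liftIsometry_apply_apply,
    PiTensorProduct.lift.tprod]
  rfl

end Tensor

/-! ### Vanishing of bar cohomology with dual coefficients -/

section BarExact

/-- `Z` is complemented in its bidual. -/
def IsBidualRetract (Z : Type*) [NormedAddCommGroup Z] [NormedSpace ℂ Z] : Prop :=
  ∃ π : StrongDual ℂ (StrongDual ℂ Z) →L[ℂ] Z,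
    ∀ z, π (NormedSpace.inclusionInDoubleDual ℂ Z z) = z

theorem isBidualRetract_of_equiv {Z : Type*} [NormedAddCommGroup Z] [NormedSpace ℂ Z]
    (e : Z ≃L[ℂ] ℂ) : IsBidualRetract Z := by
  refine ⟨(e.symm : ℂ →L[ℂ] Z) ∘L ContinuousLinearMap.apply ℂ ℂ (e : Z →L[ℂ] ℂ), fun z => ?_⟩
  simp

/-- A functional ξ on the dual of Hom(E, Z) and a vector x give the element y* ↦ ξ(T ↦ y*(T x)) of
the bidual of Z, to which the retraction of Z applies. This permits trailing slots of a cochain to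
be absorbed into its coefficients. -/
theorem IsBidualRetract.clm {Z : Type*} [NormedAddCommGroup Z] [NormedSpace ℂ Z]
    (h : IsBidualRetract Z) (E : Type*) [NormedAddCommGroup E] [NormedSpace ℂ E] :
    IsBidualRetract (E →L[ℂ] Z) := by
  obtain ⟨π, hπ⟩ := h
  let ev : E →L[ℂ] (E →L[ℂ] Z) →L[ℂ] Z := ContinuousLinearMap.flip (ContinuousLinearMap.id ℂ _)
  let d : E →L[ℂ] StrongDual ℂ Z →L[ℂ] StrongDual ℂ (E →L[ℂ] Z) :=
    (ContinuousLinearMap.compL ℂ (E →L[ℂ] Z) Z ℂ).flip ∘L ev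
  refine ⟨LinearMap.mkContinuous₂ (LinearMap.mk₂ ℂ (fun ξ x => π (ξ ∘L d x))
    (fun ξ η x => by rw [ContinuousLinearMap.add_comp, map_add])
    (fun c ξ x => by rw [ContinuousLinearMap.smul_comp, map_smul])
    (fun ξ x y => by rw [map_add, ContinuousLinearMap.comp_add, map_add])
    (fun c ξ x => by rw [map_smul, ContinuousLinearMap.comp_smul, map_smul])) (‖π‖ * ‖d‖)
    fun ξ x => ?_, fun T => ?_⟩
  · calc ‖π (ξ ∘L d x)‖ ≤ ‖π‖ * ‖ξ ∘L d x‖ := π.le_opNorm _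
      _ ≤ ‖π‖ * (‖ξ‖ * (‖d‖ * ‖x‖)) := by
        gcongr
        exact (ξ.opNorm_comp_le _).trans (by gcongr; exact d.le_opNorm x)
      _ = _ := by ring
  · ext x
    exact hπ (T x)

variable {A : Type u} [NonUnitalNormedRing A] [NormedSpace ℂ A] [SMulCommClass ℂ A A]
  [IsScalarTower ℂ A A]

/-- The sum `∑_{i < r} (-1)^i φ (d_i a)` of the first `r` terms of the bar coboundary. -/
def barSum {Z : Type*} [AddCommGroup Z] [Module ℂ Z] (r : ℕ) {n : ℕ} (φ : (Fin n → A) → Z)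
    (a : Fin (n + 1) → A) : Z :=
  ∑ i : Fin n, if (i : ℕ) < r then (-1 : ℂ) ^ (i : ℕ) • φ (innerFace i a) else 0

/-- The elementary tensor in `A^{⊗̂ n}`, as a bounded multilinear map. -/
def projPure (A : Type u) [NonUnitalNormedRing A] [NormedSpace ℂ A] (n : ℕ) :
    ContinuousMultilinearMap ℂ (fun _ : Fin n => A) (ProjPower A n) :=
  (Completion.toComplL : (⨂[ℂ] _ : Fin n, A) →L[ℂ] _).compContinuousMultilinearMap
    (PiTensorProduct.tprodL ℂ)

theorem projPure_apply {n : ℕ} (a : Fin n → A) :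
    projPure A n a = ((PiTensorProduct.tprod ℂ a : ⨂[ℂ] _ : Fin n, A) : ProjPower A n) := rfl

theorem barL_projPure {n : ℕ} (a : Fin (n + 1) → A) :
    barL A n (projPure A (n + 1) a) =
      ∑ i : Fin n, (-1 : ℂ) ^ (i : ℕ) • projPure A n (innerFace i a) := by
  rw [projPure_apply, barL, ContinuousLinearMap.completion_apply_coe]
  simp only [sum_apply, smul_apply,
    PiTensorProduct.liftIsometry_apply_apply, PiTensorProduct.lift.tprod]
  change (Completion.toComplL : (⨂[ℂ] _ : Fin n, A) →L[ℂ] _) _ = _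
  rw [map_sum]
  simp only [map_smul]
  rfl

theorem barL_zero : barL A 0 = 0 := by
  refine completion_tensor_ext fun m => ?_
  have h := barL_projPure (n := 0) m
  rw [projPure_apply] at h
  rw [h]
  simp

/-- By exactness the range is a kernel; at the end of the complex the differential is zero. -/
theorem isClosed_range_idTensor_barL (hH : IsStronglyHUnital A) (X : Type u)
    [NormedAddCommGroup X] [NormedSpace ℂ X] [CompleteSpace X] (n : ℕ) :
    IsClosed (Set.range (idTensor X (barL A n))) := by
  cases n with
  | zero =>
    have h0 : idTensor X (barL A 0) = 0 := projTensor_ext (f := idTensor X (barL A 0)) (g := 0)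
      fun x t => by
        rw [idTensor_tmulL, barL_zero]
        simp
    rw [h0]
    convert isClosed_singleton (x := (0 : ProjTensor X (ProjPower A 0)))
    ext y
    simp
  | succ n =>
    have h := hH X n
    have : Set.range (idTensor X (barL A (n + 1))) = {y | idTensor X (barL A n) y = 0} := by
      ext y
      exact (h y).symm
    rw [this]
    exact isClosed_eq (idTensor X (barL A n)).continuous continuous_const

theorem exists_factor_idTensor_barL (hH : IsStronglyHUnital A) (X : Type u)
    [NormedAddCommGroup X] [NormedSpace ℂ X] [CompleteSpace X] {n : ℕ}
    (F : ProjTensor X (ProjPower A (n + 1)) →L[ℂ] ℂ)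
    (hF : ∀ t, F (idTensor X (barL A (n + 1)) t) = 0) :
    ∃ G : ProjTensor X (ProjPower A n) →L[ℂ] ℂ, F = G ∘L idTensor X (barL A n) :=
  exists_factor_of_isClosed_range _ (isClosed_range_idTensor_barL hH X n) F fun v hv => by
    obtain ⟨w, rfl⟩ := (hH X n v).1 hv
    exact hF w

/-- Duality turns a Z-valued cochain into a functional on Z* ⊗̂ A^{⊗̂(n+1)}. The cocycle condition
lets this functional factor through id ⊗̂ β; the factor is a cochain with values in the bidual of Z,
and the retraction brings it back to Z. -/
theorem exists_barSum_of_isBidualRetract (hH : IsStronglyHUnital A) {Z : Type u}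
    [NormedAddCommGroup Z] [NormedSpace ℂ Z] [CompleteSpace Z] (hZ : IsBidualRetract Z) {n : ℕ}
    (φ : ContinuousMultilinearMap ℂ (fun _ : Fin (n + 1) => A) Z)
    (hφ : ∀ a, ∑ i : Fin (n + 1), (-1 : ℂ) ^ (i : ℕ) • φ (innerFace i a) = 0) :
    ∃ ψ : ContinuousMultilinearMap ℂ (fun _ : Fin n => A) Z,
      ∀ a, φ a = ∑ i : Fin n, (-1 : ℂ) ^ (i : ℕ) • ψ (innerFace i a) := by
  obtain ⟨π, hπ⟩ := hZ
  let X := StrongDual ℂ Z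
  let f : ProjPower A (n + 1) →L[ℂ] Z :=
    extendCompletion (PiTensorProduct.liftIsometry ℂ _ _ φ)
  have hf : ∀ a, f (projPure A (n + 1) a) = φ a := fun a => by
    rw [projPure_apply, extendCompletion_coe, PiTensorProduct.liftIsometry_apply_apply,
      PiTensorProduct.lift.tprod]
    rfl
  let F : ProjTensor X (ProjPower A (n + 1)) →L[ℂ] ℂ :=
    liftBilin ((ContinuousLinearMap.compL ℂ _ Z ℂ).flip f)
  have hF : ∀ x t, F (tmulL X _ x t) = x (f t) := fun x t => liftBilin_tmulL _ _ _
  have hfbar : f ∘L barL A (n + 1) = 0 := completion_tensor_ext fun a => by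
    have h := barL_projPure (n := n + 1) a
    rw [projPure_apply] at h
    rw [ContinuousLinearMap.comp_apply, h, map_sum]
    simp only [map_smul, hf, hφ, zero_apply]
  have hFbar : F.comp (idTensor X (barL A (n + 1))) = 0 :=
    projTensor_ext (f := F.comp (idTensor X (barL A (n + 1)))) (g := 0) fun x t => by
      rw [ContinuousLinearMap.comp_apply, idTensor_tmulL, hF]
      have := DFunLike.congr_fun hfbar t
      rw [ContinuousLinearMap.comp_apply] at this
      rw [this]
      simp
  obtain ⟨G, hG⟩ := exists_factor_idTensor_barL hH X F fun w => DFunLike.congr_fun hFbar w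
  -- The map sends y to π(x ↦ G(x ⊗ y)).
  let g : ProjPower A n →L[ℂ] Z :=
    π ∘L (ContinuousLinearMap.compL ℂ X _ ℂ G) ∘L (tmulL X (ProjPower A n)).flip
  refine ⟨g.compContinuousMultilinearMap (projPure A n), fun a => ?_⟩
  have h1 : g (barL A n (projPure A (n + 1) a)) = φ a := by
    rw [← hπ (φ a)]
    change π _ = _
    congr 1
    ext x
    change G (tmulL X _ x (barL A n (projPure A (n + 1) a))) = x (φ a)
    rw [← idTensor_tmulL, ← hf, ← hF, hG]
    rfl
  rw [← h1, barL_projPure, map_sum]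
  simp only [map_smul]
  rfl

theorem innerFace_snoc {n : ℕ} (i : Fin n) (a : Fin (n + 1) → A) (x : A) :
    innerFace i.castSucc (Fin.snoc (α := fun _ => A) a x) =
      Fin.snoc (α := fun _ => A) (innerFace i a) x := by
  ext k
  have := i.isLt
  simp only [innerFace, Fin.contractNth, Fin.snoc, Fin.val_castSucc, Fin.val_succ, cast_eq,
    Fin.castLT]
  split_ifs <;> first | rfl | omega

/-- The first r + 1 faces do not touch the slots after them. While r < n, the last slot is a
parameter and can be curried into the coefficients; when r = n, the whole bar differential is
present. -/
theorem exists_eq_barSum_of_retract (hH : IsStronglyHUnital A) (n : ℕ) :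
    ∀ {Z : Type u} [NormedAddCommGroup Z] [NormedSpace ℂ Z] [CompleteSpace Z]
    (_ : IsBidualRetract Z) {r : ℕ} (_ : r ≤ n)
    (φ : ContinuousMultilinearMap ℂ (fun _ : Fin (n + 1) => A) Z)
    (_ : ∀ a, barSum (r + 1) φ a = 0),
    ∃ ψ : ContinuousMultilinearMap ℂ (fun _ : Fin n => A) Z, ∀ a, φ a = barSum r ψ a := by
  induction n with
  | zero =>
    intro Z _ _ _ hZ r hr φ hφ
    obtain rfl : r = 0 := by omega
    obtain ⟨ψ, hψ⟩ := exists_barSum_of_isBidualRetract hH hZ φ fun a => by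
      simpa [barSum] using hφ a
    exact ⟨ψ, fun a => by simpa [barSum] using hψ a⟩
  | succ n ih =>
    intro Z _ _ _ hZ r hr φ hφ
    rcases hr.eq_or_lt with rfl | hr
    · obtain ⟨ψ, hψ⟩ := exists_barSum_of_isBidualRetract hH hZ φ fun a => by
        rw [← hφ a, barSum]
        exact Finset.sum_congr rfl fun i _ => (if_pos i.isLt).symm
      refine ⟨ψ, fun a => ?_⟩
      rw [hψ a, barSum]
      exact Finset.sum_congr rfl fun i _ => (if_pos i.isLt).symm
    · obtain ⟨ψ, hψ⟩ := ih (hZ.clm A) (r := r) (by omega) φ.curryRight fun a => by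
        ext x
        have h := hφ (Fin.snoc (α := fun _ => A) a x)
        rw [barSum, Fin.sum_univ_castSucc] at h
        simp only [innerFace_snoc] at h
        rw [if_neg (by simp; omega), add_zero] at h
        rw [barSum, sum_apply, zero_apply, ← h]
        refine Finset.sum_congr rfl fun i _ => ?_
        simp only [Fin.val_castSucc]
        split_ifs <;> simp
      refine ⟨ContinuousMultilinearMap.uncurryRight (Ei := fun _ => A) ψ, fun a => ?_⟩
      have h := DFunLike.congr_fun (hψ (Fin.init a)) (a (Fin.last _))
      rw [ContinuousMultilinearMap.curryRight_apply, Fin.snoc_init_self] at h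
      rw [h, barSum, barSum, sum_apply, Fin.sum_univ_castSucc,
        if_neg (by simp; omega), add_zero]
      refine Finset.sum_congr rfl fun i _ => ?_
      have ha : innerFace i.castSucc a =
          Fin.snoc (α := fun _ => A) (innerFace i (Fin.init a)) (a (Fin.last _)) := by
        rw [← innerFace_snoc, Fin.snoc_init_self]
      rw [ha]
      simp only [Fin.val_castSucc]
      split_ifs <;> simp

/-- If the first `r + 1` terms of the bar coboundary of a bounded cochain cancel, the cochain is
the sum of the first `r` terms of the bar coboundary of a bounded cochain. -/
theorem exists_eq_barSum (hH : IsStronglyHUnital A) {n r : ℕ} (hr : r ≤ n)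
    (φ : ContinuousMultilinearMap ℂ (fun _ : Fin (n + 1) => A) ℂ)
    (hφ : ∀ a, barSum (r + 1) φ a = 0) :
    ∃ ψ : ContinuousMultilinearMap ℂ (fun _ : Fin n => A) ℂ, ∀ a, φ a = barSum r ψ a := by
  -- Strong H-unitality is quantified over Banach spaces in the universe of `A`, so the scalars are
  -- lifted there.
  let e : ULift.{u} ℂ ≃L[ℂ] ℂ := ContinuousLinearEquiv.ulift
  obtain ⟨ψ, hψ⟩ := exists_eq_barSum_of_retract hH n (isBidualRetract_of_equiv e) hr
    ((e.symm : ℂ →L[ℂ] ULift.{u} ℂ).compContinuousMultilinearMap φ) fun a => by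
      have h := congrArg e.symm (hφ a)
      rw [barSum, map_sum, map_zero] at h
      rw [← h, barSum]
      refine Finset.sum_congr rfl fun i _ => ?_
      split_ifs
      · rw [map_smul]; rfl
      · rw [map_zero]
  refine ⟨(e : ULift.{u} ℂ →L[ℂ] ℂ).compContinuousMultilinearMap ψ, fun a => ?_⟩
  have h := congrArg e (hψ a)
  rw [barSum, map_sum] at h
  refine Eq.trans (by simp) (h.trans ?_)
  rw [barSum]
  refine Finset.sum_congr rfl fun i _ => ?_
  split_ifs <;> simp

/-- A bounded functional that vanishes on all products is zero. -/
theorem eq_zero_of_vanish_on_mul (hH : IsStronglyHUnital A) (f : A →L[ℂ] ℂ)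
    (hf : ∀ a b, f (a * b) = 0) : f = 0 := by
  obtain ⟨ψ, hψ⟩ := exists_eq_barSum hH (n := 0) (r := 0) le_rfl
    (f.compContinuousMultilinearMap
      (ContinuousMultilinearMap.ofSubsingleton ℂ A A (0 : Fin 1) (ContinuousLinearMap.id ℂ A)))
    fun a => by
      simp [barSum, innerFace, Fin.contractNth, hf]
  ext a
  simpa [barSum] using hψ fun _ => a

end BarExact

open Function Filter Topology

section

variable {A : Type u} [NonUnitalNormedRing A] [NormedSpace ℂ A] [SMulCommClass ℂ A A]
  [IsScalarTower ℂ A A]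

/-! ### The action of multipliers -/

theorem lmul_mul (T T' : multipliers A) (a : A) : lmul (T * T') a = lmul T (lmul T' a) := rfl

theorem rmul_mul (T T' : multipliers A) (a : A) : rmul a (T * T') = rmul (rmul a T) T' := rfl

@[simp] theorem lmul_one (a : A) : lmul (1 : multipliers A) a = a := rfl

@[simp] theorem rmul_one (a : A) : rmul a (1 : multipliers A) = a := rfl

theorem lmul_mul_right (T : multipliers A) (a b : A) : lmul T (a * b) = lmul T a * b := T.2.1 a b

theorem rmul_mul_left (T : multipliers A) (a b : A) : rmul (a * b) T = a * rmul b T := T.2.2 a b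

theorem rmul_mul_eq_mul_lmul (T : multipliers A) (a b : A) : rmul a T * b = a * lmul T b :=
  T.1.central a b

/-- Left multiplication as a linear map in the multiplier. -/
def lmulₗ (a : A) : multipliers A →ₗ[ℂ] A where
  toFun T := lmul T a
  map_add' _ _ := rfl
  map_smul' _ _ := rfl

/-- Right multiplication as a linear map in the multiplier. -/
def rmulₗ (a : A) : multipliers A →ₗ[ℂ] A where
  toFun T := rmul a T
  map_add' _ _ := rfl
  map_smul' _ _ := rfl

theorem lmulₗ_apply (T : multipliers A) (a : A) : lmulₗ a T = lmul T a := rfl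

theorem rmulₗ_apply (T : multipliers A) (a : A) : rmulₗ a T = rmul a T := rfl

/-- The left and right actions of multipliers of a strongly H-unital algebra commute. -/
theorem lmul_rmul_comm (hH : IsStronglyHUnital A) (T T' : multipliers A) (a : A) :
    lmul T (rmul a T') = rmul (lmul T a) T' := by
  -- The commutator of the two actions vanishes on products, hence so does its composition with any
  -- bounded functional; such functionals are zero, and Hahn–Banach gives D = 0.
  let D : A →L[ℂ] A := T.1.fst ∘L T'.1.snd - T'.1.snd ∘L T.1.fst
  have hD : ∀ a b, D (a * b) = 0 := fun a b => by
    change lmul T (rmul (a * b) T') - rmul (lmul T (a * b)) T' = 0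
    rw [rmul_mul_left, lmul_mul_right, lmul_mul_right, rmul_mul_left, sub_self]
  have h : D a = 0 := by
    by_contra hne
    obtain ⟨f, -, hf⟩ := exists_dual_vector ℂ (D a) (norm_ne_zero_iff.2 hne)
    have h0 : f ∘L D = 0 := eq_zero_of_vanish_on_mul hH _ fun x y => by simp [hD]
    have h1 : f (D a) = 0 := DFunLike.congr_fun h0 a
    rw [h1] at hf
    exact hne (norm_eq_zero.1 (Complex.ofReal_eq_zero.1 hf.symm))
  exact sub_eq_zero.1 h

/-! ### Matrix units -/

section MatrixUnits

variable {S R : multipliers A} (hRS : R * S = 1)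

/-- The complementary projection `S^N R^N = 1 - ∑_{i < N} E_{ii}`. -/
def tailProj (S R : multipliers A) (N : ℕ) : multipliers A := S ^ N * R ^ N

include hRS

theorem corner_proj_mul_pow {k : ℕ} (hk : 0 < k) : (1 - S * R) * S ^ k = 0 := by
  obtain ⟨k, rfl⟩ := Nat.exists_eq_succ_of_ne_zero hk.ne'
  rw [Nat.succ_eq_add_one, pow_succ', ← mul_assoc, sub_mul, one_mul, mul_assoc, hRS, mul_one,
    sub_self, zero_mul]

theorem pow_mul_corner_proj {k : ℕ} (hk : 0 < k) : R ^ k * (1 - S * R) = 0 := by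
  obtain ⟨k, rfl⟩ := Nat.exists_eq_succ_of_ne_zero hk.ne'
  rw [Nat.succ_eq_add_one, pow_succ, mul_assoc, mul_sub, mul_one, ← mul_assoc R, hRS, one_mul,
    sub_self, mul_zero]

theorem pow_mul_pow_of_le {j k : ℕ} (h : k ≤ j) : R ^ j * S ^ k = R ^ (j - k) := by
  obtain ⟨d, rfl⟩ := Nat.exists_eq_add_of_le h
  rw [add_comm k d, pow_add, mul_assoc, pow_mul_pow_eq_one k hRS, mul_one, Nat.add_sub_cancel]

theorem pow_mul_pow_of_ge {j k : ℕ} (h : j ≤ k) : R ^ j * S ^ k = S ^ (k - j) := by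
  obtain ⟨d, rfl⟩ := Nat.exists_eq_add_of_le h
  rw [pow_add, ← mul_assoc, pow_mul_pow_eq_one j hRS, one_mul, Nat.add_sub_cancel_left]

/-- The inner factor R^j S^k collapses to a power of S or of R. Unless j = k this power is positive
and is killed by the adjacent projection 1 - SR. -/
theorem matrixUnit_mul_matrixUnit (i j k l : ℕ) :
    matrixUnit S R i j * matrixUnit S R k l = if j = k then matrixUnit S R i l else 0 := by
  have h : matrixUnit S R i j * matrixUnit S R k l =
      S ^ i * ((1 - S * R) * (R ^ j * S ^ k) * (1 - S * R)) * R ^ l := by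
    simp only [matrixUnit, mul_assoc]
  rw [h]
  rcases lt_trichotomy j k with hjk | rfl | hjk
  · rw [pow_mul_pow_of_ge hRS hjk.le, corner_proj_mul_pow hRS (by omega), zero_mul, mul_zero,
      zero_mul, if_neg hjk.ne]
  · have h1 := corner_proj_mul_pow hRS (S := S) (R := R) one_pos
    rw [pow_one] at h1
    rw [pow_mul_pow_eq_one j hRS, mul_one, mul_sub, mul_one, ← mul_assoc (1 - S * R), h1, zero_mul,
      sub_zero, if_pos rfl, matrixUnit]
  · rw [pow_mul_pow_of_le hRS hjk.le, mul_assoc (1 - S * R), pow_mul_corner_proj hRS (by omega), mul_zero,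
      mul_zero, zero_mul, if_neg hjk.ne']

theorem tailProj_mul_matrixUnit {N k : ℕ} (h : k < N) (l : ℕ) :
    tailProj S R N * matrixUnit S R k l = 0 := by
  have h' : tailProj S R N * matrixUnit S R k l =
      S ^ N * (R ^ N * S ^ k * (1 - S * R)) * R ^ l := by
    simp only [tailProj, matrixUnit, mul_assoc]
  rw [h', pow_mul_pow_of_le hRS h.le, pow_mul_corner_proj hRS (by omega), mul_zero, zero_mul]

theorem matrixUnit_mul_tailProj {N l : ℕ} (h : l < N) (k : ℕ) :
    matrixUnit S R k l * tailProj S R N = 0 := by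
  have h' : matrixUnit S R k l * tailProj S R N =
      S ^ k * ((1 - S * R) * (R ^ l * S ^ N)) * R ^ N := by
    simp only [tailProj, matrixUnit, mul_assoc]
  rw [h', pow_mul_pow_of_ge hRS h.le, corner_proj_mul_pow hRS (by omega), mul_zero, zero_mul]

theorem tailProj_mul_self (N : ℕ) : tailProj S R N * tailProj S R N = tailProj S R N := by
  have h : tailProj S R N * tailProj S R N = S ^ N * (R ^ N * S ^ N) * R ^ N := by
    simp only [tailProj, mul_assoc]
  rw [h, pow_mul_pow_eq_one N hRS, mul_one, tailProj]

omit hRS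

theorem matrixUnit_self (i : ℕ) :
    matrixUnit S R i i = tailProj S R i - tailProj S R (i + 1) := by
  rw [matrixUnit, tailProj, tailProj, mul_sub, sub_mul, mul_one, pow_succ S, pow_succ' R]
  simp only [mul_assoc]

theorem sum_matrixUnit_self (N : ℕ) :
    ∑ i ∈ Finset.range N, matrixUnit S R i i = 1 - tailProj S R N := by
  simp only [matrixUnit_self]
  rw [Finset.sum_range_sub']
  simp [tailProj]

theorem lmul_matrixUnit_eq_zero {K j : ℕ} (h : K ≤ j) (i : ℕ) {a : A}
    (ha : lmul (R ^ K) a = 0) : lmul (matrixUnit S R i j) a = 0 := by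
  rw [matrixUnit, lmul_mul, lmul_pow_eq_zero R h ha]
  exact map_zero _

theorem rmul_matrixUnit_eq_zero {K i : ℕ} (h : K ≤ i) (j : ℕ) {a : A}
    (ha : rmul a (S ^ K) = 0) : rmul a (matrixUnit S R i j) = 0 := by
  rw [matrixUnit, mul_assoc, rmul_mul, rmul_pow_eq_zero S h ha]
  exact map_zero _

/-! ### Signed permutations -/

/-- The multiplier of a signed permutation matrix of size `N`. -/
def signedPermMul (S R : multipliers A) {N : ℕ} (ε : Fin N → ℂ) (σ : Equiv.Perm (Fin N)) :
    multipliers A :=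
  tailProj S R N + ∑ i, ε i • matrixUnit S R i (σ i)

/-- The infinite signed permutation matrix that extends one of size `N`. -/
def signedPermMatrix {N : ℕ} (ε : Fin N → ℂ) (σ : Equiv.Perm (Fin N)) : Matrix ℕ ℕ ℂ :=
  fun i j => (if h : i < N then ε ⟨i, h⟩ else 1) *
    (σ.extendDomain (Fin.equivSubtype (n := N))).permMatrix ℂ i j

theorem extendDomain_apply_of_lt {N i : ℕ} (σ : Equiv.Perm (Fin N)) (h : i < N) :
    σ.extendDomain (Fin.equivSubtype (n := N)) i = σ ⟨i, h⟩ :=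
  Equiv.Perm.extendDomain_apply_image σ Fin.equivSubtype ⟨i, h⟩

theorem extendDomain_apply_of_le {N i : ℕ} (σ : Equiv.Perm (Fin N)) (h : N ≤ i) :
    σ.extendDomain (Fin.equivSubtype (n := N)) i = i :=
  Equiv.Perm.extendDomain_apply_not_subtype σ Fin.equivSubtype (by omega)

theorem signedPermMatrix_of_lt {N i : ℕ} (ε : Fin N → ℂ) (σ : Equiv.Perm (Fin N)) (h : i < N)
    (j : ℕ) : signedPermMatrix ε σ i j = if (σ ⟨i, h⟩ : ℕ) = j then ε ⟨i, h⟩ else 0 := by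
  simp [signedPermMatrix, h, Equiv.Perm.permMatrix, PEquiv.toMatrix_apply,
    extendDomain_apply_of_lt σ h]

theorem signedPermMatrix_of_le {N i : ℕ} (ε : Fin N → ℂ) (σ : Equiv.Perm (Fin N)) (h : N ≤ i)
    (j : ℕ) : signedPermMatrix ε σ i j = if i = j then 1 else 0 := by
  simp [signedPermMatrix, h.not_gt, Equiv.Perm.permMatrix, PEquiv.toMatrix_apply,
    extendDomain_apply_of_le σ h]

theorem signedPermMatrix_mem {N : ℕ} {ε : Fin N → ℂ} (hε : ∀ i, ε i = 1 ∨ ε i = -1)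
    (σ : Equiv.Perm (Fin N)) : signedPermMatrix ε σ ∈ signedPermutations := by
  refine ⟨fun i => if h : i < N then ε ⟨i, h⟩ else 1, σ.extendDomain (Fin.equivSubtype (n := N)),
    fun i => ?_, ?_, ?_, fun i j => rfl⟩
  · by_cases h : i < N
    · simpa [h] using hε ⟨i, h⟩
    · simp [h]
  · refine (Set.finite_lt_nat N).subset fun i hi => ?_
    by_contra h
    have h' : ¬ i < N := h
    simp only [Set.mem_ofPred_eq, dif_neg h'] at hi
    norm_num at hi
  · refine (Set.finite_lt_nat N).subset fun i hi => ?_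
    by_contra h
    exact hi (extendDomain_apply_of_le σ (not_lt.1 h))

/-- Beyond N the matrix is the identity, and its diagonal units between N and M telescope to a
difference of tail projections. -/
theorem sum_signedPermMatrix {N M : ℕ} (h : N ≤ M) (ε : Fin N → ℂ) (σ : Equiv.Perm (Fin N)) :
    ∑ i ∈ Finset.range M, ∑ j ∈ Finset.range M, signedPermMatrix ε σ i j • matrixUnit S R i j =
      signedPermMul S R ε σ - tailProj S R M := by
  have h1 : ∀ i ∈ Finset.range M,
      ∑ j ∈ Finset.range M, signedPermMatrix ε σ i j • matrixUnit S R i j =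
        if h : i < N then ε ⟨i, h⟩ • matrixUnit S R i (σ ⟨i, h⟩) else matrixUnit S R i i := by
    intro i hi
    rw [Finset.mem_range] at hi
    split_ifs with hiN
    · have := (σ ⟨i, hiN⟩).isLt
      simp only [signedPermMatrix_of_lt ε σ hiN, ite_smul, zero_smul]
      rw [Finset.sum_ite_eq, if_pos (Finset.mem_range.2 (by omega))]
    · simp only [signedPermMatrix_of_le ε σ (not_lt.1 hiN), ite_smul, zero_smul, one_smul]
      rw [Finset.sum_ite_eq, if_pos (Finset.mem_range.2 hi)]
  rw [Finset.sum_congr rfl h1, ← Finset.sum_range_add_sum_Ico _ h]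
  have h2 : ∑ i ∈ Finset.Ico N M, (if h : i < N then ε ⟨i, h⟩ • matrixUnit S R i (σ ⟨i, h⟩)
      else matrixUnit S R i i) = tailProj S R N - tailProj S R M := by
    rw [Finset.sum_congr rfl fun i hi => dif_neg (not_lt.2 (Finset.mem_Ico.1 hi).1),
      Finset.sum_Ico_eq_sub _ h, sum_matrixUnit_self, sum_matrixUnit_self]
    abel
  rw [h2, ← Fin.sum_univ_eq_sum_range
    (fun i => if h : i < N then ε ⟨i, h⟩ • matrixUnit S R i (σ ⟨i, h⟩) else matrixUnit S R i i)]
  simp only [Fin.is_lt, dite_true, Fin.eta, signedPermMul]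
  abel

/-- On corners the formal sum in M3 is the action of a genuine bounded multiplier. This allows the
bound of M3 to pass to the closure. -/
theorem matrixRMul_signedPermMatrix {N K : ℕ} (ε : Fin N → ℂ) (σ : Equiv.Perm (Fin N)) {a : A}
    (ha : rmul a (S ^ K) = 0) :
    matrixRMul S R a (signedPermMatrix ε σ) = rmul a (signedPermMul S R ε σ) := by
  have hNM := le_max_right K N
  have hKM := le_max_left K N
  set M := max K N
  have hQ : rmul a (tailProj S R M) = 0 := by
    rw [tailProj, rmul_mul, rmul_pow_eq_zero S hKM ha]
    exact map_zero _
  rw [matrixRMul, finsum_eq_sum_of_support_subset (s := Finset.range M ×ˢ Finset.range M)]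
  · rw [Finset.sum_product]
    have h := congrArg (rmulₗ a) (sum_signedPermMatrix (S := S) (R := R) hNM ε σ)
    simp only [map_sum, map_smul, map_sub, rmulₗ_apply, hQ, sub_zero] at h
    exact h
  · rintro ⟨i, j⟩ hij
    rw [mem_support] at hij
    simp only [Finset.coe_product, Finset.coe_range, Set.mem_prod, Set.mem_Iio]
    have hi : i < M := by
      by_contra hi
      exact hij (by rw [rmul_matrixUnit_eq_zero (by omega) _ ha, smul_zero])
    refine ⟨hi, ?_⟩
    by_contra hj
    refine hij ?_
    have : signedPermMatrix ε σ i j = 0 := by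
      by_cases hiN : i < N
      · have := (σ ⟨i, hiN⟩).isLt
        rw [signedPermMatrix_of_lt ε σ hiN, if_neg (by omega)]
      · rw [signedPermMatrix_of_le ε σ (not_lt.1 hiN), if_neg (by omega)]
    simp only [this, zero_smul]

theorem matrixLMul_signedPermMatrix {N K : ℕ} (ε : Fin N → ℂ) (σ : Equiv.Perm (Fin N)) {a : A}
    (ha : lmul (R ^ K) a = 0) :
    matrixLMul S R (signedPermMatrix ε σ) a = lmul (signedPermMul S R ε σ) a := by
  have hNM := le_max_right K N
  have hKM := le_max_left K N
  set M := max K N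
  have hQ : lmul (tailProj S R M) a = 0 := by
    rw [tailProj, lmul_mul, lmul_pow_eq_zero R hKM ha]
    exact map_zero _
  rw [matrixLMul, finsum_eq_sum_of_support_subset (s := Finset.range M ×ˢ Finset.range M)]
  · rw [Finset.sum_product]
    have h := congrArg (lmulₗ a) (sum_signedPermMatrix (S := S) (R := R) hNM ε σ)
    simp only [map_sum, map_smul, map_sub, lmulₗ_apply, hQ, sub_zero] at h
    exact h
  · rintro ⟨i, j⟩ hij
    rw [mem_support] at hij
    simp only [Finset.coe_product, Finset.coe_range, Set.mem_prod, Set.mem_Iio]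
    have hj : j < M := by
      by_contra hj
      exact hij (by rw [lmul_matrixUnit_eq_zero (by omega) _ ha, smul_zero])
    refine ⟨?_, hj⟩
    by_contra hi
    refine hij ?_
    have : signedPermMatrix ε σ i j = 0 := by
      rw [signedPermMatrix_of_le ε σ (by omega), if_neg (by omega)]
    simp only [this, zero_smul]

/-- The signed permutation multipliers are uniformly bounded on the whole algebra. -/
theorem exists_norm_signedPermMul_le (hM1 : ConditionM1 S R) (hM3 : ConditionM3 S R) :
    ∃ C : ℝ, 1 ≤ C ∧ ∀ {N : ℕ} (ε : Fin N → ℂ) (_ : ∀ i, ε i = 1 ∨ ε i = -1)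
      (σ : Equiv.Perm (Fin N)) (a : A), ‖rmul a (signedPermMul S R ε σ)‖ ≤ C * ‖a‖ ∧
        ‖lmul (signedPermMul S R ε σ) a‖ ≤ C * ‖a‖ := by
  obtain ⟨C, -, hC⟩ := hM3
  -- The constant is made at least 1 so that it also bounds slots on which nothing acts.
  refine ⟨max C 1, le_max_right _ _, fun {N} ε hε σ a => ?_⟩
  have hcl : IsClosed {a : A | ‖rmul a (signedPermMul S R ε σ)‖ ≤ max C 1 * ‖a‖ ∧
      ‖lmul (signedPermMul S R ε σ) a‖ ≤ max C 1 * ‖a‖} :=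
    (isClosed_le ((signedPermMul S R ε σ).1.snd.continuous.norm)
      (continuous_const.mul continuous_norm)).inter
    (isClosed_le ((signedPermMul S R ε σ).1.fst.continuous.norm)
      (continuous_const.mul continuous_norm))
  refine hcl.closure_subset_iff.2 (fun b hb => ?_) (hM1.1 a)
  obtain ⟨h1, h2⟩ := hC _ (signedPermMatrix_mem hε σ) b hb
  obtain ⟨-, K, -, hK1, hK2⟩ := hb
  rw [matrixRMul_signedPermMatrix ε σ hK2] at h1
  rw [matrixLMul_signedPermMatrix ε σ hK1] at h2
  have := mul_le_mul_of_nonneg_right (le_max_left C 1) (norm_nonneg b)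
  exact ⟨h1.trans this, h2.trans this⟩

end MatrixUnits

end

section

variable {A : Type u} [NonUnitalNormedRing A] [NormedSpace ℂ A] [SMulCommClass ℂ A A]
  [IsScalarTower ℂ A A] {m : ℕ}

/-! ### Normalized cochains -/

/-- `φ` is normalized at the gap between the slots `s` and `t`: matrix units can be moved from the
right of the slot `s` to the left of the slot `t`. -/
def IsNormalizedAt (S R : multipliers A) (s t : Fin m) (φ : (Fin m → A) → ℂ) : Prop :=
  ∀ (i j : ℕ) (a : Fin m → A), φ (update a s (rmul (a s) (matrixUnit S R i j))) =
    φ (update a t (lmul (matrixUnit S R i j) (a t)))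

/-- The multipliers that can be moved across the gap between the slots `s` and `t` of `φ`. -/
def normalizer (s t : Fin m) (φ : ContinuousMultilinearMap ℂ (fun _ : Fin m => A) ℂ) :
    Submodule ℂ (multipliers A) where
  carrier := {T | ∀ a : Fin m → A, φ (update a s (rmul (a s) T)) = φ (update a t (lmul T (a t)))}
  zero_mem' a := by
    simp only [← lmulₗ_apply, ← rmulₗ_apply, map_zero]
    exact (φ.map_coord_zero s (by simp)).trans (φ.map_coord_zero t (by simp)).symm
  add_mem' {T T'} h h' a := by
    simp only [← lmulₗ_apply, ← rmulₗ_apply, map_add]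
    rw [φ.map_update_add, φ.map_update_add]
    exact congrArg₂ _ (h a) (h' a)
  smul_mem' c T h a := by
    simp only [← lmulₗ_apply, ← rmulₗ_apply, map_smul]
    rw [φ.map_update_smul, φ.map_update_smul]
    exact congrArg _ (h a)

variable {S R : multipliers A} {s t : Fin m}
  {φ ψ : ContinuousMultilinearMap ℂ (fun _ : Fin m => A) ℂ}

theorem one_mem_normalizer : (1 : multipliers A) ∈ normalizer s t φ := fun a => by simp

theorem IsNormalizedAt.matrixUnit_mem (h : IsNormalizedAt S R s t φ) (i j : ℕ) :
    matrixUnit S R i j ∈ normalizer s t φ := h i j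

theorem IsNormalizedAt.tailProj_mem (h : IsNormalizedAt S R s t φ) (N : ℕ) :
    tailProj S R N ∈ normalizer s t φ := by
  have h' : tailProj S R N = 1 - ∑ i ∈ Finset.range N, matrixUnit S R i i := by
    rw [sum_matrixUnit_self, sub_sub_cancel]
  rw [h']
  exact sub_mem one_mem_normalizer (sum_mem fun i _ => h.matrixUnit_mem i i)

theorem IsNormalizedAt.sub {f g : (Fin m → A) → ℂ} (hf : IsNormalizedAt S R s t f)
    (hg : IsNormalizedAt S R s t g) : IsNormalizedAt S R s t fun a => f a - g a :=
  fun i j a => congrArg₂ _ (hf i j a) (hg i j a)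

/-! ### Averaging over a gap -/

/-- Multiply the slot `s` by `T` from the right and the slot `t` by `T'` from the left. -/
def gapAct (s t : Fin m) (T T' : multipliers A) (a : Fin m → A) : Fin m → A :=
  update (update a s (rmul (a s) T)) t (lmul T' (a t))

/-- The average of `φ` over the signed permutation matrices of size `N + 1`, acting across the gap
between the slots `s` and `t`. -/
def gapAverage (S R : multipliers A) (s t : Fin m) (N : ℕ) (φ : (Fin m → A) → ℂ)
    (a : Fin m → A) : ℂ :=
  ((N + 1 : ℕ) : ℂ)⁻¹ * ∑ i : Fin (N + 1), ∑ j : Fin (N + 1),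
    φ (gapAct s t (matrixUnit S R i j) (matrixUnit S R j i) a) +
  φ (gapAct s t (tailProj S R (N + 1)) (tailProj S R (N + 1)) a)

/-- `ψ` is the limit of the averages of `φ` along a fixed nonprincipal ultrafilter. -/
def IsGapMean (S R : multipliers A) (s t : Fin m) (φ ψ : (Fin m → A) → ℂ) : Prop :=
  ∀ a, Tendsto (fun N => gapAverage S R s t N φ a) (hyperfilter ℕ : Filter ℕ) (𝓝 (ψ a))

/-- The bounded operator that `gapAct` applies to the slot `k`. -/
def gapMap (s t : Fin m) (T T' : multipliers A) (k : Fin m) : A →L[ℂ] A :=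
  if k = t then T'.1.fst else if k = s then T.1.snd else ContinuousLinearMap.id ℂ A

theorem gapMap_apply (hst : s ≠ t) (T T' : multipliers A) (a : Fin m → A) :
    (fun k => gapMap s t T T' k (a k)) = gapAct s t T T' a := by
  funext k
  simp only [gapMap, gapAct, update_apply]
  split_ifs with h1 h2
  · subst h1; rfl
  · subst h2; rfl
  · rfl

theorem gapAct_comp_left (hst : s ≠ t) (T T' E : multipliers A) (a : Fin m → A) :
    gapAct s t T T' (update a s (rmul (a s) E)) = gapAct s t (E * T) T' a := by
  simp [gapAct, hst.symm, rmul_mul]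

theorem gapAct_comp_right (hst : s ≠ t) (T T' E : multipliers A) (a : Fin m → A) :
    gapAct s t T T' (update a t (lmul E (a t))) = gapAct s t T (T' * E) a := by
  simp [gapAct, hst, lmul_mul, update_comm hst]

theorem map_gapAct_zero_left (hst : s ≠ t) (T' : multipliers A) (a : Fin m → A) :
    φ (gapAct s t 0 T' a) = 0 := by
  rw [gapAct, update_comm hst]
  exact φ.map_coord_zero s (by simp [← rmulₗ_apply])

theorem map_gapAct_zero_right (T : multipliers A) (a : Fin m → A) :
    φ (gapAct s t T 0 a) = 0 :=
  φ.map_coord_zero t (by simp [gapAct, ← lmulₗ_apply])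

/-- If a multiplier can be moved across the gap, then it can be absorbed on the right. -/
theorem map_gapAct_of_mem (hst : s ≠ t) {T : multipliers A} (hT : T ∈ normalizer s t φ)
    (T' : multipliers A) (a : Fin m → A) :
    φ (gapAct s t T T' a) = φ (update a t (lmul (T * T') (a t))) := by
  have h := hT (update a t (lmul T' (a t)))
  rw [update_of_ne hst, update_idem, update_self] at h
  rw [gapAct, update_comm hst, h, lmul_mul]

section

variable (hRS : R * S = 1)

include hRS

/-- Moving E_ij across the gap produces E_ij E_ji = E_ii. The sum over j gives N + 1 equal terms,
cancelling the factor, and the E_ii together with the tail projection add up to 1. -/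
theorem gapAverage_eq_self (hst : s ≠ t) (h : IsNormalizedAt S R s t φ) (N : ℕ) (a : Fin m → A) :
    gapAverage S R s t N φ a = φ a := by
  have hN : ((N + 1 : ℕ) : ℂ) ≠ 0 := Nat.cast_ne_zero.2 N.succ_ne_zero
  simp only [gapAverage, map_gapAct_of_mem hst (h.matrixUnit_mem _ _),
    map_gapAct_of_mem hst (h.tailProj_mem _), matrixUnit_mul_matrixUnit hRS, if_true,
    tailProj_mul_self hRS, Finset.sum_const, Finset.card_univ, Fintype.card_fin, nsmul_eq_mul]
  rw [← Finset.mul_sum, inv_mul_cancel_left₀ hN]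
  refine (congrArg (· + _) (φ.toMultilinearMap.map_update_sum _ _ _ _).symm).trans ?_
  refine (φ.map_update_add _ _ _ _).symm.trans ?_
  have h1 : ∑ i : Fin (N + 1), lmul (matrixUnit S R i i) (a t) +
      lmul (tailProj S R (N + 1)) (a t) = a t := by
    simp only [← lmulₗ_apply]
    rw [← map_sum, ← map_add, Fin.sum_univ_eq_sum_range (fun i => matrixUnit S R i i),
      sum_matrixUnit_self, sub_add_cancel]
    rfl
  rw [h1, update_eq_self]

/-- Inserting E_kl on either side of ∑ E_ij ⊗ E_ji leaves ∑_j E_kj ⊗ E_jl, and the tail terms vanish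
because k and l lie in the averaged block. -/
theorem gapAverage_move (hst : s ≠ t) {N k l : ℕ} (hk : k < N + 1) (hl : l < N + 1)
    (a : Fin m → A) :
    gapAverage S R s t N φ (update a s (rmul (a s) (matrixUnit S R k l))) =
      gapAverage S R s t N φ (update a t (lmul (matrixUnit S R k l) (a t))) := by
  simp only [gapAverage, gapAct_comp_left hst, gapAct_comp_right hst,
    matrixUnit_mul_matrixUnit hRS, matrixUnit_mul_tailProj hRS hl, tailProj_mul_matrixUnit hRS hk,
    map_gapAct_zero_left hst, map_gapAct_zero_right]
  congr 2
  trans ∑ j : Fin (N + 1), φ (gapAct s t (matrixUnit S R k j) (matrixUnit S R j l) a)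
  · rw [Finset.sum_eq_single ⟨l, hl⟩]
    · simp
    · intro i _ hi
      refine Finset.sum_eq_zero fun j _ => ?_
      rw [if_neg (fun h => hi (Fin.ext h.symm)), map_gapAct_zero_left hst]
    · simp
  · symm
    rw [Finset.sum_eq_single ⟨k, hk⟩]
    · simp
    · intro i _ hi
      refine Finset.sum_eq_zero fun j _ => ?_
      rw [if_neg (fun h => hi (Fin.ext h)), map_gapAct_zero_right]
    · simp

theorem IsGapMean.isNormalizedAt (hst : s ≠ t) {g : (Fin m → A) → ℂ}
    (h : IsGapMean S R s t φ g) : IsNormalizedAt S R s t g := fun i j a => by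
  refine tendsto_nhds_unique_of_eventuallyEq (h _) (h _) ?_
  -- For a given matrix unit the averages satisfy the identity only once the block contains both
  -- indices, which suffices along a nonprincipal ultrafilter.
  have hev : ∀ᶠ N in (hyperfilter ℕ : Filter ℕ), max i j < N := 
    (eventually_gt_atTop _).filter_mono Nat.hyperfilter_le_atTop
  filter_upwards [hev] with N hN
  exact gapAverage_move hRS hst (by omega) (by omega) a

theorem IsGapMean.eq_of_isNormalizedAt (hst : s ≠ t) {g : (Fin m → A) → ℂ}
    (h : IsGapMean S R s t φ g) (hφ : IsNormalizedAt S R s t φ) (a : Fin m → A) : g a = φ a := by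
  refine tendsto_nhds_unique (h a) ?_
  simp only [gapAverage_eq_self hRS hst hφ]
  exact tendsto_const_nhds

end

/-- Averaging over one gap preserves normalization at every other gap. -/
theorem IsGapMean.isNormalizedAt_of_ne (hH : IsStronglyHUnital A) (hst : s ≠ t) {s' t' : Fin m}
    (hs : s' ≠ s) (ht : t' ≠ t) {f g : (Fin m → A) → ℂ} (h : IsGapMean S R s t f g)
    (hf : IsNormalizedAt S R s' t' f) : IsNormalizedAt S R s' t' g := fun i j a => by
  -- The two gaps can share a slot only with a left action from one and a right action from the
  -- other, and these commute.
  have key : ∀ T T' : multipliers A,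
      f (gapAct s t T T' (update a s' (rmul (a s') (matrixUnit S R i j)))) =
        f (gapAct s t T T' (update a t' (lmul (matrixUnit S R i j) (a t')))) := fun T T' => by
    have h1 : gapAct s t T T' (update a s' (rmul (a s') (matrixUnit S R i j))) =
        update (gapAct s t T T' a) s' (rmul (gapAct s t T T' a s') (matrixUnit S R i j)) := by
      funext k
      by_cases h1 : s' = t
      · subst h1
        simp only [gapAct, update_apply, hs.symm, if_false, if_true]
        split_ifs <;> first | rfl | exact lmul_rmul_comm hH _ _ _
      · simp only [gapAct, update_apply, hs, h1, Ne.symm h1, hs.symm, if_false]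
        split_ifs <;> simp_all
    have h2 : gapAct s t T T' (update a t' (lmul (matrixUnit S R i j) (a t'))) =
        update (gapAct s t T T' a) t' (lmul (matrixUnit S R i j) (gapAct s t T T' a t')) := by
      funext k
      by_cases h1 : t' = s
      · subst h1
        simp only [gapAct, update_apply, hst, ht.symm, if_false, if_true]
        split_ifs <;> first | rfl | exact (lmul_rmul_comm hH _ _ _).symm |
          exact absurd (‹k = t'›.symm.trans ‹k = t›) ht
      · simp only [gapAct, update_apply, ht, h1, Ne.symm h1, ht.symm, if_false]
        split_ifs <;> simp_all
    rw [h1, h2]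
    exact hf i j _
  refine tendsto_nhds_unique_of_eventuallyEq (h _) (h _) (Eventually.of_forall fun N => ?_)
  simp only [gapAverage, key]

/-! ### Existence of means -/

/-- Averaging over signs: if all the signed sums are bounded by `M` under a bilinear form, so is the
diagonal sum. -/
theorem norm_add_sum_le_of_signs {E F ι : Type*} [AddCommGroup E] [Module ℂ E] [AddCommGroup F]
    [Module ℂ F] (B : E →ₗ[ℂ] F →ₗ[ℂ] ℂ) (M : ℝ) (x : ι → E) (y : ι → F) (I : Finset ι) :
    ∀ (x₀ : E) (y₀ : F), (∀ ε : ι → ℂ, (∀ i, ε i = 1 ∨ ε i = -1) →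
      ‖B (x₀ + ∑ i ∈ I, ε i • x i) (y₀ + ∑ i ∈ I, ε i • y i)‖ ≤ M) →
    ‖B x₀ y₀ + ∑ i ∈ I, B (x i) (y i)‖ ≤ M := by
  classical
  induction I using Finset.induction_on with
  | empty => intro x₀ y₀ h; simpa using h (fun _ => 1) fun _ => Or.inl rfl
  | insert k I hk ih =>
    intro x₀ y₀ h
    have hsign : ∀ c : ℂ, c = 1 ∨ c = -1 →
        ‖B (x₀ + c • x k) (y₀ + c • y k) + ∑ i ∈ I, B (x i) (y i)‖ ≤ M := fun c hc => by
      refine ih _ _ fun ε hε => ?_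
      have h1 := h (update ε k c) fun i => by
        by_cases hik : i = k
        · subst hik; simpa using hc
        · simpa [hik] using hε i
      rw [Finset.sum_insert hk, Finset.sum_insert hk, update_self, ← add_assoc, ← add_assoc] at h1
      have hne : ∀ i ∈ I, update ε k c i = ε i := fun i hi =>
        update_of_ne (fun h : i = k => hk (h ▸ hi)) _ _
      have hx : ∑ i ∈ I, update ε k c i • x i = ∑ i ∈ I, ε i • x i :=
        Finset.sum_congr rfl fun i hi => by rw [hne i hi]
      have hy : ∑ i ∈ I, update ε k c i • y i = ∑ i ∈ I, ε i • y i :=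
        Finset.sum_congr rfl fun i hi => by rw [hne i hi]
      rwa [hx, hy] at h1
    have hp := hsign 1 (Or.inl rfl)
    have hm := hsign (-1) (Or.inr rfl)
    -- Adding the values for the signs 1 and -1 cancels the cross terms of the bilinear form.
    have heq : B x₀ y₀ + ∑ i ∈ insert k I, B (x i) (y i) = (2 : ℂ)⁻¹ *
        ((B (x₀ + (1 : ℂ) • x k) (y₀ + (1 : ℂ) • y k) + ∑ i ∈ I, B (x i) (y i)) +
        (B (x₀ + (-1 : ℂ) • x k) (y₀ + (-1 : ℂ) • y k) + ∑ i ∈ I, B (x i) (y i))) := by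
      rw [Finset.sum_insert hk]
      simp only [map_add, map_smul, LinearMap.add_apply, LinearMap.smul_apply, smul_eq_mul]
      ring
    rw [heq, norm_mul, norm_inv, Complex.norm_ofNat]
    have := norm_add_le (B (x₀ + (1 : ℂ) • x k) (y₀ + (1 : ℂ) • y k) + ∑ i ∈ I, B (x i) (y i))
      (B (x₀ + (-1 : ℂ) • x k) (y₀ + (-1 : ℂ) • y k) + ∑ i ∈ I, B (x i) (y i))
    linarith

/-- The bilinear form obtained from `φ` by freezing all slots but `s` and `t`. -/
def slotBilin (hst : s ≠ t) (φ : ContinuousMultilinearMap ℂ (fun _ : Fin m => A) ℂ)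
    (a : Fin m → A) : A →ₗ[ℂ] A →ₗ[ℂ] ℂ :=
  LinearMap.mk₂ ℂ (fun x y => φ (update (update a s x) t y))
    (fun x x' y => by simp only [update_comm hst]; exact φ.map_update_add _ _ _ _)
    (fun c x y => by simp only [update_comm hst]; exact φ.map_update_smul _ _ _ _)
    (fun x y y' => φ.map_update_add _ _ _ _)
    (fun c x y => φ.map_update_smul _ _ _ _)

theorem slotBilin_apply (hst : s ≠ t) (a : Fin m → A) (x y : A) :
    slotBilin hst φ a x y = φ (update (update a s x) t y) := rfl

theorem norm_slotBilin_le (hst : s ≠ t) {C : ℝ} (hC : 1 ≤ C) (a : Fin m → A) {x y : A}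
    (hx : ‖x‖ ≤ C * ‖a s‖) (hy : ‖y‖ ≤ C * ‖a t‖) :
    ‖slotBilin hst φ a x y‖ ≤ ‖φ‖ * C ^ m * ∏ k, ‖a k‖ := by
  rw [slotBilin_apply, mul_assoc]
  refine (φ.le_opNorm _).trans (mul_le_mul_of_nonneg_left ?_ (norm_nonneg φ))
  have h : C ^ m * ∏ k, ‖a k‖ = ∏ k, (C * ‖a k‖) := by
    rw [Finset.prod_mul_distrib, Finset.prod_const, Finset.card_univ, Fintype.card_fin]
  rw [h]
  refine Finset.prod_le_prod (fun _ _ => norm_nonneg _) fun k _ => ?_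
  by_cases hkt : k = t
  · subst hkt; simpa using hy
  · rw [update_of_ne hkt]
    by_cases hks : k = s
    · subst hks; simpa using hx
    · rw [update_of_ne hks]
      exact le_mul_of_one_le_left (norm_nonneg _) hC

/-- The (N+1)² pairs (i, j) split into N + 1 cyclic permutations i ↦ i + k. For each of them a sign
average isolates the diagonal terms of U ⊗ U⁻¹, with U a signed permutation, so they obey the bound
for signed permutations. The prefactor then averages over k. -/
theorem norm_gapAverage_le (hst : s ≠ t) {C : ℝ} (hC1 : 1 ≤ C)
    (hC : ∀ {N : ℕ} (ε : Fin N → ℂ) (_ : ∀ i, ε i = 1 ∨ ε i = -1)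
      (σ : Equiv.Perm (Fin N)) (a : A), ‖rmul a (signedPermMul S R ε σ)‖ ≤ C * ‖a‖ ∧
        ‖lmul (signedPermMul S R ε σ) a‖ ≤ C * ‖a‖) (N : ℕ) (a : Fin m → A) :
    ‖gapAverage S R s t N φ a‖ ≤ ‖φ‖ * C ^ m * ∏ k, ‖a k‖ := by
  set M := ‖φ‖ * C ^ m * ∏ k, ‖a k‖
  have hN : ((N + 1 : ℕ) : ℂ) ≠ 0 := Nat.cast_ne_zero.2 N.succ_ne_zero
  let B := slotBilin hst φ a
  let Q := tailProj S R (N + 1)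
  have hk : ∀ k : Fin (N + 1), ‖B (rmul (a s) Q) (lmul Q (a t)) +
      ∑ i : Fin (N + 1), B (rmul (a s) (matrixUnit S R i (i + k : Fin (N + 1))))
        (lmul (matrixUnit S R (i + k : Fin (N + 1)) i) (a t))‖ ≤ M := fun k => by
    refine norm_add_sum_le_of_signs B M _ _ Finset.univ _ _ fun ε hε => ?_
    let σ : Equiv.Perm (Fin (N + 1)) := Equiv.addRight k
    have h1 : rmul (a s) Q + ∑ i : Fin (N + 1),
        ε i • rmul (a s) (matrixUnit S R i (i + k : Fin (N + 1))) =
        rmul (a s) (signedPermMul S R ε σ) := by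
      simp only [← rmulₗ_apply, signedPermMul, map_add, map_sum, map_smul]
      rfl
    -- This is the inverse signed permutation: its signs are carried along by σ.
    have h2 : lmul Q (a t) + ∑ i : Fin (N + 1),
        ε i • lmul (matrixUnit S R (i + k : Fin (N + 1)) i) (a t) =
        lmul (signedPermMul S R (ε ∘ σ.symm) σ.symm) (a t) := by
      simp only [← lmulₗ_apply, signedPermMul, map_add, map_sum, map_smul]
      congr 1
      rw [← Equiv.sum_comp σ fun x => (ε ∘ σ.symm) x • lmulₗ (a t) (matrixUnit S R x (σ.symm x))]
      simp only [comp_apply, Equiv.symm_apply_apply]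
      rfl
    rw [h1, h2]
    exact norm_slotBilin_le hst hC1 a (hC ε hε σ _).1
      (hC (ε ∘ σ.symm) (fun i => hε _) σ.symm _).2
  have heq : gapAverage S R s t N φ a = ((N + 1 : ℕ) : ℂ)⁻¹ * ∑ k : Fin (N + 1),
      (B (rmul (a s) Q) (lmul Q (a t)) +
      ∑ i : Fin (N + 1), B (rmul (a s) (matrixUnit S R i (i + k : Fin (N + 1))))
        (lmul (matrixUnit S R (i + k : Fin (N + 1)) i) (a t))) := by
    rw [Finset.sum_add_distrib, Finset.sum_const, Finset.card_univ, Fintype.card_fin, nsmul_eq_mul,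
      mul_add, inv_mul_cancel_left₀ hN, add_comm, Finset.sum_comm]
    have h : ∀ i : Fin (N + 1), ∑ k : Fin (N + 1),
        B (rmul (a s) (matrixUnit S R i (i + k : Fin (N + 1))))
          (lmul (matrixUnit S R (i + k : Fin (N + 1)) i) (a t)) = ∑ j : Fin (N + 1),
        B (rmul (a s) (matrixUnit S R i j)) (lmul (matrixUnit S R j i) (a t)) := fun i =>
      Equiv.sum_comp (Equiv.addLeft i) fun j : Fin (N + 1) =>
        B (rmul (a s) (matrixUnit S R i j)) (lmul (matrixUnit S R j i) (a t))
    simp only [h]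
    rfl
  rw [heq, norm_mul, norm_inv, Complex.norm_natCast, inv_mul_le_iff₀ (by positivity)]
  refine (norm_sum_le_of_le _ fun k _ => hk k).trans_eq ?_
  rw [Finset.sum_const, Finset.card_univ, Fintype.card_fin, nsmul_eq_mul]

theorem exists_isGapMean (hM1 : ConditionM1 S R) (hM3 : ConditionM3 S R) (hst : s ≠ t)
    (φ : ContinuousMultilinearMap ℂ (fun _ : Fin m => A) ℂ) :
    ∃ ψ : ContinuousMultilinearMap ℂ (fun _ : Fin m => A) ℂ, IsGapMean S R s t φ ψ := by
  obtain ⟨C, hC1, hC⟩ := exists_norm_signedPermMul_le hM1 hM3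
  have hbd := norm_gapAverage_le (φ := φ) hst hC1 hC
  have hlim : ∀ a : Fin m → A, ∃ c : ℂ, ‖c‖ ≤ ‖φ‖ * C ^ m * ∏ k, ‖a k‖ ∧
      Tendsto (fun N => gapAverage S R s t N φ a) (hyperfilter ℕ : Filter ℕ) (𝓝 c) := fun a => by
    obtain ⟨c, hc, hc'⟩ := (isCompact_closedBall (0 : ℂ) (‖φ‖ * C ^ m * ∏ k, ‖a k‖)
      ).ultrafilter_le_nhds ((hyperfilter ℕ).map fun N => gapAverage S R s t N φ a) (by
        rw [le_principal_iff]
        exact mem_map.2 (univ_mem' fun N => by simpa using hbd N a))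
    exact ⟨c, by simpa using hc, hc'⟩
  choose f hf hft using hlim
  -- Each average is itself multilinear, and the multilinear identities pass to the limit.
  let av : ℕ → ContinuousMultilinearMap ℂ (fun _ : Fin m => A) ℂ := fun N =>
    ((N + 1 : ℕ) : ℂ)⁻¹ • ∑ i : Fin (N + 1), ∑ j : Fin (N + 1),
      φ.compContinuousLinearMap (gapMap s t (matrixUnit S R i j) (matrixUnit S R j i)) +
      φ.compContinuousLinearMap (gapMap s t (tailProj S R (N + 1)) (tailProj S R (N + 1)))
  have hav : ∀ N a, gapAverage S R s t N φ a = av N a := fun N a => by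
    simp only [av, add_apply, smul_apply,
      sum_apply, ContinuousMultilinearMap.compContinuousLinearMap_apply,
      gapMap_apply hst, smul_eq_mul]
    rfl
  simp only [hav] at hft
  refine ⟨MultilinearMap.mkContinuous (⟨f, ?_, ?_⟩ : MultilinearMap ℂ (fun _ : Fin m => A) ℂ)
    (‖φ‖ * C ^ m) hf, fun a => ?_⟩
  · intro inst a i x y
    rw [Subsingleton.elim inst (instDecidableEqFin m)]
    refine tendsto_nhds_unique (hft _) ?_
    simp only [ContinuousMultilinearMap.map_update_add]
    exact (hft _).add (hft _)
  · intro inst a i c x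
    rw [Subsingleton.elim inst (instDecidableEqFin m)]
    refine tendsto_nhds_unique (hft _) ?_
    simp only [ContinuousMultilinearMap.map_update_smul]
    exact (hft _).const_smul c
  · simp only [hav]
    exact hft a

end

section

variable {A : Type u} [NonUnitalNormedRing A] [NormedSpace ℂ A] [SMulCommClass ℂ A A]
  [IsScalarTower ℂ A A]

/-! ### Faces and multipliers -/

theorem lastFace_apply {n : ℕ} (a : Fin (n + 2) → A) (k : Fin (n + 1)) :
    lastFace a k = if (k : ℕ) = 0 then a (Fin.last (n + 1)) * a 0 else a k.castSucc := by
  refine Fin.cases ?_ (fun k => ?_) k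
  · simp [lastFace]
  · simp [lastFace]

theorem innerFace_apply {n : ℕ} (i : Fin n) (a : Fin (n + 1) → A) (k : Fin n) :
    innerFace i a k = if (k : ℕ) < i then a k.castSucc
      else if (k : ℕ) = i then a k.castSucc * a k.succ else a k.succ := rfl

/-- The excluded case is s = i: there the multiplier lands inside the product a_i a_{i+1}. -/
theorem innerFace_rmul {n : ℕ} (i : Fin n) (a : Fin (n + 1) → A) (T : multipliers A)
    {s : Fin (n + 1)} {s' : Fin n}
    (h : (s : ℕ) < i ∧ (s' : ℕ) = s ∨ (i : ℕ) < s ∧ (s' : ℕ) + 1 = s) :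
    innerFace i (update a s (rmul (a s) T)) =
      update (innerFace i a) s' (rmul (innerFace i a s') T) := by
  rcases h with ⟨h, h'⟩ | ⟨h, h'⟩
  · obtain rfl : s = s'.castSucc := Fin.ext h'.symm
    simp only [Fin.val_castSucc] at h
    ext k
    simp only [innerFace_apply, update_apply, Fin.ext_iff, Fin.val_castSucc, Fin.val_succ]
    split_ifs <;> first | rfl | omega
  · obtain rfl : s = s'.succ := Fin.ext h'.symm
    simp only [Fin.val_succ] at h
    ext k
    simp only [innerFace_apply, update_apply, Fin.ext_iff, Fin.val_castSucc, Fin.val_succ]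
    split_ifs <;> first | rfl | omega | skip
    obtain rfl : k = s' := Fin.ext (by omega)
    rw [rmul_mul_left]

/-- Here the excluded slot is t = i + 1, again inside the product. -/
theorem innerFace_lmul {n : ℕ} (i : Fin n) (a : Fin (n + 1) → A) (T : multipliers A)
    {t : Fin (n + 1)} {t' : Fin n}
    (h : (t : ℕ) ≤ i ∧ (t' : ℕ) = t ∨ (i : ℕ) + 1 < t ∧ (t' : ℕ) + 1 = t) :
    innerFace i (update a t (lmul T (a t))) =
      update (innerFace i a) t' (lmul T (innerFace i a t')) := by
  rcases h with ⟨h, h'⟩ | ⟨h, h'⟩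
  · obtain rfl : t = t'.castSucc := Fin.ext h'.symm
    simp only [Fin.val_castSucc] at h
    ext k
    simp only [innerFace_apply, update_apply, Fin.ext_iff, Fin.val_castSucc, Fin.val_succ]
    split_ifs <;> first | rfl | omega | skip
    obtain rfl : k = t' := Fin.ext (by omega)
    rw [lmul_mul_right]
  · obtain rfl : t = t'.succ := Fin.ext h'.symm
    simp only [Fin.val_succ] at h
    ext k
    simp only [innerFace_apply, update_apply, Fin.ext_iff, Fin.val_castSucc, Fin.val_succ]
    split_ifs <;> first | rfl | omega

/-- The two excluded cases agree by (aT)b = a(Tb): every face is automatically normalized at the gap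
that it contracts. -/
theorem innerFace_move {n : ℕ} (i : Fin n) (a : Fin (n + 1) → A) (T : multipliers A) :
    innerFace i (update a i.castSucc (rmul (a i.castSucc) T)) =
      innerFace i (update a i.succ (lmul T (a i.succ))) := by
  ext k
  simp only [innerFace_apply, update_apply, Fin.ext_iff, Fin.val_castSucc, Fin.val_succ]
  split_ifs <;> first | rfl | omega | skip
  obtain rfl : k = i := Fin.ext (by omega)
  exact rmul_mul_eq_mul_lmul _ _ _

theorem lastFace_rmul {n : ℕ} (a : Fin (n + 2) → A) (T : multipliers A) (s : Fin (n + 1)) :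
    lastFace (update a s.castSucc (rmul (a s.castSucc) T)) =
      update (lastFace a) s (rmul (lastFace a s) T) := by
  ext k
  have := s.isLt
  simp only [lastFace_apply, update_apply, Fin.ext_iff, Fin.val_castSucc, Fin.val_last,
    Fin.val_zero]
  split_ifs <;> first | rfl | omega | skip
  obtain rfl : s = 0 := Fin.ext (show (s : ℕ) = 0 by omega)
  exact (rmul_mul_left _ _ _).symm

theorem lastFace_lmul {n : ℕ} (a : Fin (n + 2) → A) (T : multipliers A) {t : Fin (n + 2)}
    {t' : Fin (n + 1)} (h0 : (t : ℕ) ≠ 0)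
    (h : (t' : ℕ) = t ∨ (t : ℕ) = n + 1 ∧ (t' : ℕ) = 0) :
    lastFace (update a t (lmul T (a t))) = update (lastFace a) t' (lmul T (lastFace a t')) := by
  have h1 := t'.isLt
  rcases h with h | ⟨h, h'⟩
  · obtain rfl : t = t'.castSucc := Fin.ext h.symm
    simp only [Fin.val_castSucc] at h0
    ext k
    simp only [lastFace_apply, update_apply, Fin.ext_iff, Fin.val_castSucc, Fin.val_last,
      Fin.val_zero]
    split_ifs <;> first | rfl | omega
  · obtain rfl : t = Fin.last (n + 1) := Fin.ext h
    obtain rfl : t' = 0 := Fin.ext h'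
    ext k
    have := k.isLt
    simp only [lastFace_apply, update_apply, Fin.ext_iff, Fin.val_castSucc, Fin.val_last,
      Fin.val_zero]
    split_ifs <;> first | rfl | omega | contradiction | exact (lmul_mul_right T _ _).symm

theorem lastFace_move {n : ℕ} (a : Fin (n + 2) → A) (T : multipliers A) :
    lastFace (update a (Fin.last (n + 1)) (rmul (a (Fin.last (n + 1))) T)) =
      lastFace (update a 0 (lmul T (a 0))) := by
  ext k
  have := k.isLt
  simp only [lastFace_apply, update_apply, Fin.ext_iff, Fin.val_castSucc, Fin.val_last,
    Fin.val_zero]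
  split_ifs <;> first | rfl | omega | contradiction | exact rmul_mul_eq_mul_lmul T _ _

/-! ### Cochains normalized at all gaps from a given one on -/

/-- The slot `t` follows the slot `s` in the cyclic order. -/
def Consecutive {m : ℕ} (s t : Fin m) : Prop :=
  (t : ℕ) = s + 1 ∨ ((s : ℕ) + 1 = m ∧ (t : ℕ) = 0)

theorem exists_consecutive {m r : ℕ} (h : r < m) :
    ∃ s t : Fin m, (s : ℕ) = r ∧ Consecutive s t := by
  by_cases h' : r + 1 < m
  · exact ⟨⟨r, h⟩, ⟨r + 1, h'⟩, rfl, Or.inl rfl⟩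
  · exact ⟨⟨r, h⟩, ⟨0, by omega⟩, rfl, Or.inr ⟨by simp; omega, rfl⟩⟩

/-- `φ` is normalized at all gaps from the one after the slot `r` on, including the cyclic one. -/
def NormalizedFrom (S R : multipliers A) {m : ℕ} (r : ℕ) (φ : (Fin m → A) → ℂ) : Prop :=
  ∀ s t : Fin m, Consecutive s t → r ≤ s → IsNormalizedAt S R s t φ

/-- The terms of the Hochschild coboundary that are not in `barSum r`. -/
def tailSum (r : ℕ) {n : ℕ} (φ : (Fin (n + 1) → A) → ℂ) (a : Fin (n + 2) → A) : ℂ :=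
  (∑ i : Fin (n + 1), if r ≤ (i : ℕ) then (-1 : ℂ) ^ (i : ℕ) * φ (innerFace i a) else 0) +
    (-1 : ℂ) ^ (n + 1) * φ (lastFace a)

theorem boundedCoboundary_apply {n : ℕ} (φ : BoundedCochain A n) (a : Fin (n + 2) → A) :
    boundedCoboundary A n φ a =
      ∑ i : Fin (n + 1), (-1 : ℂ) ^ (i : ℕ) * φ (innerFace i a) +
        (-1 : ℂ) ^ (n + 1) * φ (lastFace a) := by
  simp [boundedCoboundary]

theorem boundedCoboundary_eq_add (r : ℕ) {n : ℕ} (φ : BoundedCochain A n) (a : Fin (n + 2) → A) :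
    boundedCoboundary A n φ a = barSum r φ a + tailSum r φ a := by
  rw [boundedCoboundary_apply, barSum, tailSum, ← add_assoc, ← Finset.sum_add_distrib]
  congr 1
  refine Finset.sum_congr rfl fun i _ => ?_
  rw [smul_eq_mul]
  split_ifs <;> first | omega | simp

variable {S R : multipliers A}

/-- A face of index k ≥ r contracts gap k. It turns a gap s ≥ r into gap s if s < k, into gap s - 1
≥ k ≥ r if s > k, and into the inside of a product if s = k. In no case is normalization needed
before gap r. -/
theorem NormalizedFrom.tailSum {r n : ℕ} {φ : (Fin (n + 1) → A) → ℂ}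
    (h : NormalizedFrom S R r φ) : NormalizedFrom S R r (tailSum r φ) := by
  intro s t hst hr i j a
  have hs := s.isLt
  have ht := t.isLt
  have inner : ∀ k : Fin (n + 1), r ≤ (k : ℕ) →
      φ (innerFace k (update a s (rmul (a s) (matrixUnit S R i j)))) =
        φ (innerFace k (update a t (lmul (matrixUnit S R i j) (a t)))) := by
    intro k hk
    have hkn := k.isLt
    rcases lt_trichotomy (k : ℕ) s with hks | hks | hks
    · obtain ⟨s', t', hs', hst'⟩ := exists_consecutive (m := n + 1) (r := (s : ℕ) - 1) (by omega)
      have ht' := t'.isLt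
      rw [innerFace_rmul k a _ (s' := s') (by omega),
        innerFace_lmul k a _ (t' := t') (by simp only [Consecutive] at hst hst'; omega)]
      exact h s' t' hst' (by omega) i j _
    · obtain rfl : s = k.castSucc := Fin.ext hks.symm
      obtain rfl : t = k.succ := Fin.ext (by
        simp only [Consecutive, Fin.val_castSucc] at hst; simp; omega)
      rw [innerFace_move]
    · have hts : (t : ℕ) = s + 1 := by simp only [Consecutive] at hst; omega
      rw [innerFace_rmul k a _ (s' := ⟨s, by omega⟩) (by simp; omega),
        innerFace_lmul k a _ (t' := ⟨t, by omega⟩) (by simp; omega)]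
      exact h _ _ (Or.inl (by simpa using hts)) (by simpa using hr) i j _
  have last : φ (lastFace (update a s (rmul (a s) (matrixUnit S R i j)))) =
      φ (lastFace (update a t (lmul (matrixUnit S R i j) (a t)))) := by
    by_cases hl : (s : ℕ) = n + 1
    · obtain rfl : s = Fin.last (n + 1) := Fin.ext hl
      obtain rfl : t = 0 := Fin.ext (show (t : ℕ) = 0 by
        simp only [Consecutive, Fin.val_last] at hst; omega)
      rw [lastFace_move]
    · obtain ⟨s', t', hs', hst'⟩ := exists_consecutive (m := n + 1) (r := (s : ℕ)) (by omega)
      have ht' := t'.isLt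
      obtain rfl : s = s'.castSucc := Fin.ext (by simp [hs'])
      simp only [Consecutive, Fin.val_castSucc] at hst hr ht
      rw [lastFace_rmul, lastFace_lmul a _ (t' := t') (by omega)
        (by simp only [Consecutive] at hst'; omega)]
      exact h s' t' hst' hr i j _
  rw [MatrixLike.tailSum, MatrixLike.tailSum, last]
  congr 1
  refine Finset.sum_congr rfl fun k _ => ?_
  split_ifs with hk
  · rw [inner k hk]
  · rfl

/-! ### Averaging and the bar coboundary -/

/-- The average over a gap as a linear map. -/
def gapAverageₗ (S R : multipliers A) {m : ℕ} (s t : Fin m) (N : ℕ) (a : Fin m → A) :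
    ((Fin m → A) → ℂ) →ₗ[ℂ] ℂ where
  toFun φ := gapAverage S R s t N φ a
  map_add' φ ψ := by
    simp only [gapAverage, Pi.add_apply, Finset.sum_add_distrib]
    ring
  map_smul' c φ := by
    simp only [gapAverage, Pi.smul_apply, smul_eq_mul, ← Finset.mul_sum, RingHom.id_apply]
    ring

theorem barSum_eq_sum (r : ℕ) {n : ℕ} (φ : (Fin n → A) → ℂ) :
    barSum r φ = ∑ i : Fin n, (if (i : ℕ) < r then (-1 : ℂ) ^ (i : ℕ) else 0) •
      fun a => φ (innerFace i a) := by
  funext a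
  rw [barSum, Finset.sum_apply]
  refine Finset.sum_congr rfl fun i _ => ?_
  simp only [Pi.smul_apply]
  split_ifs <;> simp

/-- Averaging commutes with the first faces. -/
theorem IsGapMean.barSum {r m : ℕ} {s t : Fin (m + 1)} {s' t' : Fin m} (hr : r ≤ s' + 1)
    (hs : (s : ℕ) = s' + 1) (hst : Consecutive s t) (hst' : Consecutive s' t') (hne : s' ≠ t')
    {f g : (Fin m → A) → ℂ} (h : IsGapMean S R s' t' f g) :
    IsGapMean S R s t (barSum r f) (barSum r g) := by
  have hs' := s'.isLt
  have ht' := t'.isLt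
  have ht := t.isLt
  have hne' : t ≠ s := by
    simp only [Consecutive] at hst
    exact fun h => by rw [Fin.ext_iff] at h; omega
  intro a
  -- Such a face merges slots up to s at most, so gap s of the tuple becomes gap s' = s - 1 of its
  -- face.
  have key : ∀ i : Fin m, (i : ℕ) < r → ∀ T T' : multipliers A,
      innerFace i (gapAct s t T T' a) = gapAct s' t' T T' (innerFace i a) := by
    intro i hi T T'
    have h1 := innerFace_rmul i a T (s := s) (s' := s') (by omega)
    have h2 := innerFace_lmul i (update a s (rmul (a s) T)) T' (t := t) (t' := t')
      (by simp only [Consecutive] at hst hst'; omega)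
    rw [update_of_ne hne', h1, update_of_ne hne.symm] at h2
    exact h2
  have havg : ∀ N, gapAverage S R s t N (MatrixLike.barSum r f) a =
      ∑ i : Fin m, (if (i : ℕ) < r then (-1 : ℂ) ^ (i : ℕ) else 0) *
        gapAverage S R s' t' N f (innerFace i a) := by
    intro N
    rw [barSum_eq_sum]
    refine (map_sum (gapAverageₗ S R s t N a) _ _).trans (Finset.sum_congr rfl fun i _ => ?_)
    refine (map_smul (gapAverageₗ S R s t N a) _ _).trans ?_
    by_cases hi : (i : ℕ) < r
    · simp only [if_pos hi, smul_eq_mul]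
      refine congrArg ((-1 : ℂ) ^ (i : ℕ) * ·) ?_
      change gapAverage S R s t N (fun a => f (innerFace i a)) a = _
      simp only [gapAverage, key i hi]
    · rw [if_neg hi, zero_smul, zero_mul]
  simp only [havg]
  rw [barSum_eq_sum, Finset.sum_apply]
  exact tendsto_finsetSum _ fun i _ => (h (innerFace i a)).const_mul _

/-! ### The Hochschild coboundary squares to zero -/

/-- All the faces of the Hochschild complex. -/
def face {n : ℕ} (i : Fin (n + 2)) (a : Fin (n + 2) → A) : Fin (n + 1) → A :=
  Fin.lastCases (motive := fun _ => Fin (n + 1) → A) (lastFace a) (fun i => innerFace i a) i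

@[simp]
theorem face_castSucc {n : ℕ} (i : Fin (n + 1)) (a : Fin (n + 2) → A) :
    face i.castSucc a = innerFace i a := by
  simp [face]

@[simp]
theorem face_last {n : ℕ} (a : Fin (n + 2) → A) : face (Fin.last (n + 1)) a = lastFace a := by
  simp [face]

theorem boundedCoboundary_eq_sum_face {n : ℕ} (φ : BoundedCochain A n) (a : Fin (n + 2) → A) :
    boundedCoboundary A n φ a = ∑ i : Fin (n + 2), (-1 : ℂ) ^ (i : ℕ) * φ (face i a) := by
  symm
  rw [boundedCoboundary_apply, Fin.sum_univ_castSucc]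
  simp

theorem innerFace_innerFace {n : ℕ} {i j : Fin n} (h : i ≤ j) (a : Fin (n + 2) → A) :
    innerFace i (innerFace j.succ a) = innerFace j (innerFace i.castSucc a) := by
  have h' : (i : ℕ) ≤ j := h
  ext k
  simp only [innerFace_apply, Fin.val_castSucc, Fin.val_succ, Fin.succ_castSucc]
  split_ifs <;> first | rfl | omega | exact mul_assoc _ _ _ | exact (mul_assoc _ _ _).symm

theorem innerFace_lastFace {n : ℕ} (i : Fin (n + 1)) (a : Fin (n + 3) → A) :
    innerFace i (lastFace a) = lastFace (innerFace i.castSucc a) := by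
  ext k
  have hi := i.isLt
  simp only [innerFace_apply, lastFace_apply, Fin.val_castSucc, Fin.val_succ, Fin.succ_castSucc,
    Fin.val_last, Fin.val_zero]
  rcases Nat.eq_zero_or_pos i with h0 | h0
  · simp only [h0]
    split_ifs <;> first | rfl | omega | contradiction | skip
    all_goals
      obtain rfl : k = 0 := Fin.ext (show (k : ℕ) = 0 by omega)
      exact mul_assoc _ _ _
  · simp only [h0, if_true]
    split_ifs <;> first | rfl | omega | contradiction

theorem lastFace_lastFace {n : ℕ} (a : Fin (n + 3) → A) :
    lastFace (lastFace a) = lastFace (innerFace (Fin.last (n + 1)) a) := by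
  ext k
  have := k.isLt
  simp only [innerFace_apply, lastFace_apply, Fin.val_castSucc, Fin.val_last, Fin.val_zero]
  split_ifs <;> first | rfl | omega | contradiction | exact (mul_assoc _ _ _).symm

/-- With the cyclic face included, the faces obey the uniform presimplicial identities. -/
theorem face_face {n : ℕ} {i j : Fin (n + 2)} (h : i ≤ j) (a : Fin (n + 3) → A) :
    face i (face j.succ a) = face j (face i.castSucc a) := by
  rw [face_castSucc]
  refine Fin.lastCases (fun h => ?_) (fun j h => ?_) j h
  · rw [Fin.succ_last, face_last, face_last]
    refine Fin.lastCases ?_ (fun i => ?_) i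
    · rw [face_last, lastFace_lastFace]
    · rw [face_castSucc, innerFace_lastFace]
  · rw [Fin.succ_castSucc, face_castSucc, face_castSucc]
    have hi : (i : ℕ) < n + 1 := lt_of_le_of_lt (Fin.le_def.1 h) j.isLt
    obtain ⟨i, rfl⟩ : ∃ i' : Fin (n + 1), i = i'.castSucc := ⟨⟨i, hi⟩, rfl⟩
    rw [face_castSucc]
    exact innerFace_innerFace (Fin.castSucc_le_castSucc_iff.1 h) a

/-- The entries strictly above the diagonal, (i, j + 1) with i ≤ j, pair off with the others, (j,
i). This is the cancellation behind ∂² = 0. -/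
theorem sum_eq_zero_of_antisymm {m : ℕ} (g : Fin m → Fin (m + 1) → ℂ)
    (h : ∀ i j : Fin m, i ≤ j → g i j.succ = - g j i.castSucc) : ∑ i, ∑ j, g i j = 0 := by
  have h1 : ∀ i : Fin m, ∑ j, g i j =
      (∑ j : Fin m, if j ≤ i then g i j.castSucc else 0) -
        ∑ j : Fin m, if i ≤ j then g j i.castSucc else 0 := by
    intro i
    have e1 : ∑ j : Fin (m + 1), (if j ≤ i.castSucc then g i j else 0) =
        ∑ j : Fin m, if j ≤ i then g i j.castSucc else 0 := by
      rw [Fin.sum_univ_castSucc, if_neg (by simp [Fin.le_def]), add_zero]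
      simp
    have e2 : ∑ j : Fin (m + 1), (if j ≤ i.castSucc then 0 else g i j) =
        - ∑ j : Fin m, if i ≤ j then g j i.castSucc else 0 := by
      rw [Fin.sum_univ_succ, if_pos (Fin.zero_le _), zero_add, ← Finset.sum_neg_distrib]
      refine Finset.sum_congr rfl fun j _ => ?_
      by_cases hij : i ≤ j
      · rw [if_neg (by simp only [Fin.le_def, Fin.val_succ, Fin.val_castSucc] at hij ⊢; omega),
          if_pos hij, h i j hij]
      · rw [if_pos (by simp only [Fin.le_def, Fin.val_succ, Fin.val_castSucc] at hij ⊢; omega),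
          if_neg hij, neg_zero]
    rw [← e1, sub_eq_add_neg, ← e2, ← Finset.sum_add_distrib]
    refine Finset.sum_congr rfl fun j _ => ?_
    split_ifs <;> simp
  simp only [h1, Finset.sum_sub_distrib]
  rw [sub_eq_zero, Finset.sum_comm]

theorem boundedCoboundary_boundedCoboundary {n : ℕ} (φ : BoundedCochain A n) :
    boundedCoboundary A (n + 1) (boundedCoboundary A n φ) = 0 := by
  ext a
  rw [boundedCoboundary_eq_sum_face, zero_apply]
  simp only [boundedCoboundary_eq_sum_face, Finset.mul_sum]
  rw [Finset.sum_comm]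
  refine sum_eq_zero_of_antisymm _ fun i j hij => ?_
  rw [face_face hij]
  simp only [Fin.val_succ, Fin.val_castSucc]
  ring

/-! ### Normalization of cocycles -/

/-- The cochain `barSum r φ`, as a bounded multilinear map. -/
def barSumL (r : ℕ) {n : ℕ} (φ : ContinuousMultilinearMap ℂ (fun _ : Fin n => A) ℂ) :
    ContinuousMultilinearMap ℂ (fun _ : Fin (n + 1) => A) ℂ :=
  ∑ i : Fin n, if (i : ℕ) < r then (-1 : ℂ) ^ (i : ℕ) •
    compTupleL (slotwiseLinear_innerFace i) (continuous_innerFace i) φ else 0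

theorem coe_barSumL (r : ℕ) {n : ℕ} (φ : ContinuousMultilinearMap ℂ (fun _ : Fin n => A) ℂ) :
    ⇑(barSumL r φ) = barSum r φ := by
  funext a
  rw [barSumL, barSum, sum_apply]
  refine Finset.sum_congr rfl fun i _ => ?_
  split_ifs <;> simp

theorem barSum_sub (r : ℕ) {n : ℕ} (f g : (Fin n → A) → ℂ) (a : Fin (n + 1) → A) :
    barSum r (fun a => f a - g a) a = barSum r f a - barSum r g a := by
  simp only [barSum_eq_sum, Finset.sum_apply, Pi.smul_apply, smul_eq_mul, mul_sub,
    Finset.sum_sub_distrib]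

variable (hH : IsStronglyHUnital A) (hRS : R * S = 1) (hM1 : ConditionM1 S R)
  (hM3 : ConditionM3 S R)

include hH hRS hM1 hM3

/-- A cochain whose bar sum is normalized comes from a normalized cochain with the same bar sum. -/
theorem exists_normalizedFrom_barSum {n r : ℕ} (hr : 1 ≤ r) (χ : BoundedCochain A (n + 1))
    (hχ : NormalizedFrom S R (r + 1) χ) (ψ₀ : BoundedCochain A n)
    (hψ₀ : ∀ a, χ a = barSum r ψ₀ a) :
    ∃ ψ : BoundedCochain A n, (∀ a, χ a = barSum r ψ a) ∧ NormalizedFrom S R r ψ := by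
  -- The gaps r, r + 1, … are averaged one at a time. Averaging ψ at gap r + k averages its bar sum
  -- χ at gap r + k + 1, where χ is normalized, so χ does not change. Since r ≥ 1, a gap never joins
  -- a slot to itself.
  have main : ∀ k : ℕ, ∃ ψ : BoundedCochain A n, (∀ a, χ a = barSum r ψ a) ∧
      ∀ s t : Fin (n + 1), Consecutive s t → r ≤ s → (s : ℕ) < r + k →
        IsNormalizedAt S R s t ψ := by
    intro k
    induction k with
    | zero => exact ⟨ψ₀, hψ₀, fun s t _ h1 h2 => by omega⟩
    | succ k ih =>
      obtain ⟨ψ, hψ, hψN⟩ := ih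
      by_cases hk : r + k < n + 1
      · obtain ⟨s, t, hs, hst⟩ := exists_consecutive hk
        obtain ⟨s', t', hs', hst'⟩ := exists_consecutive (m := n + 2) (r := r + k + 1) (by omega)
        have ht := t.isLt
        have ht' := t'.isLt
        have hne : s ≠ t := fun h => by
          rw [Fin.ext_iff] at h; simp only [Consecutive] at hst; omega
        have hne' : s' ≠ t' := fun h => by
          rw [Fin.ext_iff] at h; simp only [Consecutive] at hst'; omega
        obtain ⟨ψ', hψ'⟩ := exists_isGapMean hM1 hM3 hne ψ
        refine ⟨ψ', fun a => ?_, fun s₁ t₁ hst₁ hr₁ hk₁ => ?_⟩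
        · have h := hψ'.barSum (r := r) (s := s') (t := t') (by omega) (by omega) hst' hst hne
          rw [← funext hψ] at h
          exact (h.eq_of_isNormalizedAt hRS hne' (hχ s' t' hst' (by omega)) a).symm
        · have ht₁ := t₁.isLt
          by_cases h₁ : s₁ = s
          · subst h₁
            obtain rfl : t₁ = t := Fin.ext (by simp only [Consecutive] at hst hst₁; omega)
            exact hψ'.isNormalizedAt hRS hne
          · have h₂ : (s₁ : ℕ) ≠ s := fun h => h₁ (Fin.ext h)
            refine hψ'.isNormalizedAt_of_ne hH hne h₁ (fun h => ?_)
              (hψN s₁ t₁ hst₁ hr₁ (by omega))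
            rw [Fin.ext_iff] at h
            simp only [Consecutive] at hst hst₁
            omega
      · exact ⟨ψ, hψ, fun s t hst hr hs => hψN s t hst hr (by omega)⟩
  obtain ⟨ψ, hψ, hψN⟩ := main (n + 1)
  exact ⟨ψ, hψ, fun s t hst hr => hψN s t hst hr (by omega)⟩

theorem exists_normalizedFrom_sub {n r : ℕ} (hr : r ≤ n + 1) (φ : BoundedCochain A (n + 1))
    (hφ : boundedCoboundary A (n + 1) φ = 0) (hN : NormalizedFrom S R (r + 1) φ) :
    ∃ ψ : BoundedCochain A n, NormalizedFrom S R r (φ - boundedCoboundary A n ψ) := by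
  obtain ⟨s, t, hs, hst⟩ := exists_consecutive (m := n + 2) (r := r) (by omega)
  obtain ⟨s', t', hs', hst'⟩ := exists_consecutive (m := n + 3) (r := r + 1) (by omega)
  have ht := t.isLt
  have ht' := t'.isLt
  have hne : s ≠ t := fun h => by
    rw [Fin.ext_iff] at h; simp only [Consecutive] at hst; omega
  have hne' : s' ≠ t' := fun h => by
    rw [Fin.ext_iff] at h; simp only [Consecutive] at hst'; omega
  obtain ⟨φ₁, hφ₁⟩ := exists_isGapMean hM1 hM3 hne φ
  have hN₁ : NormalizedFrom S R r φ₁ := by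
    intro s₁ t₁ hst₁ hr₁
    have ht₁ := t₁.isLt
    by_cases h₁ : s₁ = s
    · subst h₁
      obtain rfl : t₁ = t := Fin.ext (by simp only [Consecutive] at hst hst₁; omega)
      exact hφ₁.isNormalizedAt hRS hne
    · have h₂ : (s₁ : ℕ) ≠ s := fun h => h₁ (Fin.ext h)
      refine hφ₁.isNormalizedAt_of_ne hH hne h₁ (fun h => ?_) (hN s₁ t₁ hst₁ (by omega))
      rw [Fin.ext_iff] at h
      simp only [Consecutive] at hst hst₁
      omega
  have hbar : ∀ a, barSum (r + 1) φ₁ a = barSum (r + 1) φ a := by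
    have hneg : ∀ a, barSum (r + 1) φ a = - tailSum (r + 1) φ a := fun a => by
      have h := boundedCoboundary_eq_add (r + 1) φ a
      rw [hφ, zero_apply] at h
      exact eq_neg_of_add_eq_zero_left h.symm
    have hnorm : IsNormalizedAt S R s' t' (barSumL (r + 1) φ) := fun i j a => by
      rw [coe_barSumL, hneg, hneg, hN.tailSum s' t' hst' (by omega) i j a]
    have hmean : IsGapMean S R s' t' (barSumL (r + 1) φ) (barSum (r + 1) φ₁) := by
      rw [coe_barSumL]
      exact hφ₁.barSum (by omega) (by omega) hst' hst hne
    intro a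
    rw [hmean.eq_of_isNormalizedAt hRS hne' hnorm a, coe_barSumL]
  have hχ : ∀ a, barSum (r + 1) (φ - φ₁ : BoundedCochain A (n + 1)) a = 0 := fun a =>
    (barSum_sub (r + 1) φ φ₁ a).trans (by rw [hbar, sub_self])
  obtain ⟨ψ₀, hψ₀⟩ := exists_eq_barSum hH hr (φ - φ₁) hχ
  -- For r = 0 the bar sum is empty, so φ already equals its mean and no coboundary is needed.
  rcases Nat.eq_zero_or_pos r with rfl | hr1
  · refine ⟨0, ?_⟩
    have h : φ = φ₁ := by
      rw [← sub_eq_zero]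
      ext a
      rw [hψ₀ a]
      simp [barSum]
    rw [map_zero, sub_zero, h]
    exact hN₁
  · obtain ⟨ψ, hψ, hψN⟩ := exists_normalizedFrom_barSum hH hRS hM1 hM3 hr1 (φ - φ₁)
      (fun s t hst hrs => (hN s t hst hrs).sub (hN₁ s t hst (by omega))) ψ₀ hψ₀
    refine ⟨ψ, ?_⟩
    have h : ⇑(φ - boundedCoboundary A n ψ) = fun a => φ₁ a - tailSum r ψ a := by
      funext a
      have h1 := boundedCoboundary_eq_add r ψ a
      rw [← hψ a, sub_apply] at h1
      rw [sub_apply, h1]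
      ring
    rw [h]
    exact fun s t hst hrs => (hN₁ s t hst hrs).sub (hψN.tailSum s t hst hrs)

/-- Every bounded cocycle is cohomologous to one that is normalized at all gaps. -/
theorem exists_normalizedFrom_zero {n : ℕ} (φ : BoundedCochain A (n + 1))
    (hφ : boundedCoboundary A (n + 1) φ = 0) :
    ∃ ψ : BoundedCochain A n, NormalizedFrom S R 0 (φ - boundedCoboundary A n ψ) := by
  -- The induction starts from r = n + 2, where there are no gaps left and the condition is vacuous.
  have main : ∀ k ≤ n + 2, ∃ ψ : BoundedCochain A n,
      NormalizedFrom S R (n + 2 - k) (φ - boundedCoboundary A n ψ) := by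
    intro k
    induction k with
    | zero => exact fun _ => ⟨0, fun s t _ h => by omega⟩
    | succ k ih =>
      intro hk
      obtain ⟨ψ, hψ⟩ := ih (by omega)
      obtain ⟨ψ', hψ'⟩ := exists_normalizedFrom_sub hH hRS hM1 hM3 (r := n + 2 - (k + 1)) (by omega)
        (φ - boundedCoboundary A n ψ)
        (by rw [map_sub, hφ, boundedCoboundary_boundedCoboundary, sub_zero])
        (by rwa [show n + 2 - (k + 1) + 1 = n + 2 - k by omega])
      refine ⟨ψ + ψ', ?_⟩
      rwa [map_add, ← sub_sub]
  simpa using main (n + 2) le_rfl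

end

section

variable {A : Type u} [NonUnitalNormedRing A] [NormedSpace ℂ A] [SMulCommClass ℂ A A]
  [IsScalarTower ℂ A A] {S R : multipliers A}

/-! ### Block diagonal matrices -/

/-- The block diagonal matrix with the `n` blocks `1, …, n` of size `k` equal to `a`. -/
def blockDiag (S R : multipliers A) (k n : ℕ) (a : A) : A :=
  ∑ l ∈ Finset.Icc 1 n, lmul (S ^ (l * k)) (rmul a (R ^ (l * k)))

/-- The partial isometry from the block `l` of size `k` to the block `0`. -/
def blockShift (S R : multipliers A) (k l : ℕ) : multipliers A := (1 - tailProj S R k) * R ^ (l * k)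

theorem corner_mono {k m : ℕ} (h : k ≤ m) {a : A} (ha : a ∈ corner S R k) : a ∈ corner S R m :=
  ⟨lmul_pow_eq_zero R h ha.1, rmul_pow_eq_zero S h ha.2⟩

/-- Cut off to k rows, R^{lk} becomes the finite sum of the units E_{i, i+lk} with i < k. -/
theorem blockShift_mem_normalizer {m : ℕ} {s t : Fin m}
    {φ : ContinuousMultilinearMap ℂ (fun _ : Fin m => A) ℂ} (h : IsNormalizedAt S R s t φ)
    (k l : ℕ) : blockShift S R k l ∈ normalizer s t φ := by
  rw [blockShift, ← sum_matrixUnit_self, Finset.sum_mul]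
  refine sum_mem fun i _ => ?_
  rw [matrixUnit, mul_assoc, ← pow_add]
  exact h.matrixUnit_mem i (i + l * k)

theorem lmul_one_sub_tailProj {k : ℕ} {a : A} (ha : a ∈ corner S R k) :
    lmul (1 - tailProj S R k) a = a := by
  rw [← lmulₗ_apply, map_sub, lmulₗ_apply, lmulₗ_apply, lmul_one, tailProj, lmul_mul, ha.1]
  exact (congrArg _ (map_zero _)).trans (sub_zero a)

theorem rmul_one_sub_tailProj {k : ℕ} {a : A} (ha : a ∈ corner S R k) :
    rmul a (1 - tailProj S R k) = a := by
  rw [← rmulₗ_apply, map_sub, rmulₗ_apply, rmulₗ_apply, rmul_one, tailProj, rmul_mul, ha.2]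
  exact (congrArg _ (map_zero _)).trans (sub_zero a)

theorem rmul_blockShift {k l : ℕ} {a : A} (ha : a ∈ corner S R k) :
    rmul a (blockShift S R k l) = rmul a (R ^ (l * k)) := by
  rw [blockShift, rmul_mul, rmul_one_sub_tailProj ha]

section

variable (hRS : R * S = 1)

include hRS

/-- For l ≠ l' the product R^{lk} S^{l'k} contains a factor R^k or S^k that the adjacent projection
kills. -/
theorem blockShift_mul_pow (k l l' : ℕ) :
    blockShift S R k l * (S ^ (l' * k) * (1 - tailProj S R k)) =
      if l = l' then 1 - tailProj S R k else 0 := by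
  have hL : (1 - tailProj S R k) * S ^ k = 0 := by
    rw [tailProj, sub_mul, one_mul, mul_assoc, pow_mul_pow_eq_one k hRS, mul_one, sub_self]
  have hR : R ^ k * (1 - tailProj S R k) = 0 := by
    rw [tailProj, mul_sub, mul_one, ← mul_assoc, pow_mul_pow_eq_one k hRS, one_mul, sub_self]
  have h : blockShift S R k l * (S ^ (l' * k) * (1 - tailProj S R k)) =
      (1 - tailProj S R k) * (R ^ (l * k) * S ^ (l' * k)) * (1 - tailProj S R k) := by
    simp only [blockShift, mul_assoc]
  rw [h]
  rcases lt_trichotomy l l' with hl | rfl | hl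
  · obtain ⟨d, rfl⟩ := Nat.exists_eq_add_of_lt hl
    rw [pow_mul_pow_of_ge hRS (Nat.mul_le_mul_right k hl.le), ← Nat.sub_mul,
      show l + d + 1 - l = 1 + d by omega, add_mul, one_mul, pow_add, ← mul_assoc, hL, zero_mul,
      zero_mul, if_neg hl.ne]
  · rw [pow_mul_pow_eq_one _ hRS, mul_one, if_pos rfl]
    rw [mul_sub, mul_one, tailProj, ← mul_assoc, ← tailProj, hL, zero_mul, sub_zero]
  · obtain ⟨d, rfl⟩ := Nat.exists_eq_add_of_lt hl
    rw [pow_mul_pow_of_le hRS (Nat.mul_le_mul_right k hl.le), ← Nat.sub_mul,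
      show l' + d + 1 - l' = d + 1 by omega, add_mul, one_mul, pow_add, mul_assoc, mul_assoc, hR,
      mul_zero, mul_zero, if_neg hl.ne']

/-- The block shifts intertwine `a` and its block diagonal multiples. -/
theorem lmul_blockShift_blockDiag (hH : IsStronglyHUnital A) {k n l : ℕ}
    (hl : l ∈ Finset.Icc 1 n) {a : A} (ha : a ∈ corner S R k) :
    lmul (blockShift S R k l) (blockDiag S R k n a) = rmul a (blockShift S R k l) := by
  have hterm : ∀ l', lmul (blockShift S R k l) (lmul (S ^ (l' * k)) (rmul a (R ^ (l' * k)))) =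
      if l = l' then rmul a (R ^ (l' * k)) else 0 := fun l' => by
    have hx : lmul (1 - tailProj S R k) (rmul a (R ^ (l' * k))) = rmul a (R ^ (l' * k)) := by
      rw [lmul_rmul_comm hH, lmul_one_sub_tailProj ha]
    conv_lhs => rw [← hx]
    rw [← lmul_mul, ← lmul_mul, mul_assoc, blockShift_mul_pow hRS]
    split_ifs
    · exact hx
    · rfl
  rw [rmul_blockShift ha, blockDiag]
  refine (map_sum (blockShift S R k l).1.fst _ _).trans ?_
  refine (Finset.sum_congr rfl fun l' _ => hterm l').trans ?_
  rw [Finset.sum_ite_eq, if_pos hl]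

/-- A block can be moved around the cycle of slots of a normalized cochain. -/
theorem map_update_block (hH : IsStronglyHUnital A) {m : ℕ}
    {φ : ContinuousMultilinearMap ℂ (fun _ : Fin (m + 1) => A) ℂ} (hφ : NormalizedFrom S R 0 φ)
    {k n l : ℕ} (hl : l ∈ Finset.Icc 1 n) {a : Fin (m + 1) → A} (ha : ∀ j, a j ∈ corner S R k) :
    φ (update (fun j => blockDiag S R k n (a j)) 0
      (lmul (S ^ (l * k)) (rmul (a 0) (R ^ (l * k))))) = φ a := by
  let W := blockShift S R k l
  let V := S ^ (l * k) * (1 - tailProj S R k)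
  -- In stage p the shift W stands to the right of slot p. Slot 0 carries V a_0, the slots 1, …, p
  -- have been reduced to a_j, and the later ones are still block diagonal. Passing slot p + 1 uses
  -- W D_n(a) = a W, and the return to slot 0 uses W V a_0 = a_0.
  let c : ℕ → Fin (m + 1) → A := fun p j =>
    if (j : ℕ) = 0 then lmul V (a 0) else if (j : ℕ) ≤ p then a j else blockDiag S R k n (a j)
  let d : ℕ → Fin (m + 1) → A := fun p j => if (j : ℕ) = p then rmul (c p j) W else c p j
  have hW : ∀ s t : Fin (m + 1), Consecutive s t → W ∈ normalizer s t φ := fun s t hst =>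
    blockShift_mem_normalizer (hφ s t hst (Nat.zero_le _)) k l
  have hd : ∀ s : Fin (m + 1), d s = update (c s) s (rmul (c s s) W) := fun s => by
    funext j
    simp only [d, update_apply, Fin.ext_iff]
    split_ifs with h
    · obtain rfl : j = s := Fin.ext h
      rfl
    · rfl
  have hstart : update (fun j => blockDiag S R k n (a j)) 0
      (lmul (S ^ (l * k)) (rmul (a 0) (R ^ (l * k)))) = d 0 := by
    funext j
    refine Fin.cases ?_ (fun j => ?_) j
    · have : lmul V (a 0) = lmul (S ^ (l * k)) (a 0) := by
        simp only [V]
        rw [lmul_mul, lmul_one_sub_tailProj (ha 0)]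
      simp only [d, c, update_self, Fin.val_zero, if_true, this, W]
      rw [← lmul_rmul_comm hH, rmul_blockShift (ha 0)]
    · simp [d, c]
  have hmove : ∀ p, p ≤ m → φ (d p) = φ (d 0) := by
    intro p
    induction p with
    | zero => intro; rfl
    | succ p ih =>
      intro hp
      rw [← ih (by omega)]
      let s : Fin (m + 1) := ⟨p, by omega⟩
      let t : Fin (m + 1) := ⟨p + 1, by omega⟩
      have h := hW s t (Or.inl rfl) (c p)
      rw [show d p = d s from rfl, hd s, h]
      congr 1
      funext j
      have h1 : lmul W (c p t) = rmul (a t) W := by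
        simp only [c, t, Nat.add_eq_zero_iff, one_ne_zero, and_false, if_false]
        rw [if_neg (by omega)]
        exact lmul_blockShift_blockDiag hRS hH hl (ha _)
      rw [h1]
      simp only [d, c, update_apply, Fin.ext_iff, t]
      split_ifs with h2 <;> first | rfl | omega | skip
      all_goals
        obtain rfl : j = t := Fin.ext h2
        rfl
  have hend : φ (d m) = φ a := by
    have h := hW (Fin.last m) 0 (Or.inr ⟨rfl, rfl⟩) (c m)
    rw [show d m = d (Fin.last m) from rfl, hd, Fin.val_last, h]
    congr 1
    funext j
    refine Fin.cases ?_ (fun j => ?_) j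
    · simp only [update_self, c, Fin.val_zero, if_true]
      rw [← lmul_mul, blockShift_mul_pow hRS, if_pos rfl, lmul_one_sub_tailProj (ha 0)]
    · simp [c]
  rw [hstart, ← hmove m le_rfl, hend]

theorem map_blockDiag (hH : IsStronglyHUnital A) {m : ℕ}
    {φ : ContinuousMultilinearMap ℂ (fun _ : Fin (m + 1) => A) ℂ} (hφ : NormalizedFrom S R 0 φ)
    (k n : ℕ) {a : Fin (m + 1) → A} (ha : ∀ j, a j ∈ corner S R k) :
    φ (fun j => blockDiag S R k n (a j)) = n * φ a := by
  have h : (fun j => blockDiag S R k n (a j)) = update (fun j => blockDiag S R k n (a j)) 0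
      (∑ l ∈ Finset.Icc 1 n, lmul (S ^ (l * k)) (rmul (a 0) (R ^ (l * k)))) :=
    (update_eq_self 0 _).symm
  rw [h]
  refine (φ.toMultilinearMap.map_update_sum _ _ _ _).trans ?_
  refine (Finset.sum_congr rfl fun l hl => map_update_block hRS hH hφ hl ha).trans ?_
  simp

/-- A bounded cochain that is normalized at all gaps vanishes. -/
theorem eq_zero_of_normalizedFrom_zero (hH : IsStronglyHUnital A) (hM1 : ConditionM1 S R) {m : ℕ}
    (φ : BoundedCochain A m) (hφ : NormalizedFrom S R 0 φ) : φ = 0 := by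
  obtain ⟨hdense, C, hC⟩ := hM1
  have hcorner : ∀ (k : ℕ) (_ : 1 ≤ k) (a : Fin (m + 1) → A) (_ : ∀ j, a j ∈ corner S R k),
      φ a = 0 := by
    intro k hk a ha
    by_contra hne
    have hpos : 0 < ‖φ a‖ := norm_pos_iff.2 hne
    -- With this many blocks, n |φ(a)| exceeds the bound that M1 gives for φ on the block diagonal
    -- matrices.
    obtain ⟨n, hn⟩ := exists_nat_gt (‖φ‖ * (∏ j, (C * ‖a j‖)) / ‖φ a‖)
    rw [div_lt_iff₀ hpos] at hn
    have h1 : ‖φ fun j => blockDiag S R k n (a j)‖ ≤ ‖φ‖ * ∏ j, (C * ‖a j‖) :=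
      (φ.le_opNorm _).trans (mul_le_mul_of_nonneg_left
        (Finset.prod_le_prod (fun _ _ => norm_nonneg _) fun j _ => hC k hk (a j) (ha j) n)
        (norm_nonneg φ))
    rw [map_blockDiag hRS hH hφ k n ha, norm_mul, Complex.norm_natCast] at h1
    linarith
  have hd : Dense (Set.univ.pi fun _ : Fin (m + 1) => (corners S R ⊤ : Set A)) :=
    dense_pi Set.univ fun _ _ => hdense
  refine DFunLike.coe_injective (Continuous.ext_on hd φ.cont continuous_const fun a ha => ?_)
  -- The corners increase, so finitely many elements lie in a common one.
  choose K hK1 hK using fun j => (ha j (Set.mem_univ j)).2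
  exact hcorner (Finset.univ.sup K) ((hK1 0).trans (Finset.le_sup (Finset.mem_univ 0))) a fun j =>
    corner_mono (Finset.le_sup (Finset.mem_univ j)) (hK j)

end

end

end MatrixLike

end

/-! ### Vanishing of bounded Hochschild cohomology -/

theorem theorem2p1 {𝔄 : Type u} [NonUnitalNormedRing 𝔄] [NormedSpace ℂ 𝔄]
    [SMulCommClass ℂ 𝔄 𝔄] [IsScalarTower ℂ 𝔄 𝔄] [CompleteSpace 𝔄]
    (hH : MatrixLike.IsStronglyHUnital 𝔄)
    (S R : MatrixLike.multipliers 𝔄) (hRS : R * S = 1) (hSR : S * R ≠ 1)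
    (hM1 : MatrixLike.ConditionM1 S R) (hM2 : MatrixLike.ConditionM2 S R)
    (hM3 : MatrixLike.ConditionM3 S R) :
    ∀ n : ℕ, 1 ≤ n → Subsingleton (MatrixLike.BoundedHochschildCohomology 𝔄 n) := by
  intro n hn
  obtain ⟨n, rfl⟩ := Nat.exists_eq_add_of_le' hn
  refine Submodule.Quotient.subsingleton_iff.2 (eq_top_iff.2 ?_)
  rintro ⟨φ, hφ⟩ -
  obtain ⟨ψ, hψ⟩ := MatrixLike.exists_normalizedFrom_zero hH hRS hM1 hM3 φ hφ
  have h := MatrixLike.eq_zero_of_normalizedFrom_zero hRS hH hM1 _ hψ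
  exact ⟨ψ, (sub_eq_zero.1 h).symm⟩
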